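/- Let $n\in\{1,2,3\}$ and let $\Omega\subset\mathbb{R}^n$ be a connected bounded open set with $C^\infty$ boundary such that the spectrum of the Dirichlet Laplacian $-\Delta:H^1_0(\Omega)\to H^{-1}(\Omega)$ is simple (every eigenspace is one-dimensional). Let $\{\phi_k\}_{k\ge 1}$ be an orthonormal basis of $L^2(\Omega)$ of Dirichlet eigenfunctions, $-\Delta\phi_k=\lambda_k\phi_k$, each taken in its continuous representative, and let $x_{\mathrm{con}},x_{\mathrm{obs}}\in\Omega$. Fix an integer $N\ge 1$ and consider the projection onto $\mathrm{span}\{\phi_1,\dots,\phi_N\}$ of the wave equation $y_{tt}-\Delta y=v(t)\delta(x-x_{\mathrm{con}})$ with homogeneous Dirichlet boundary conditions, observed at $x_{\mathrm{obs}}$, i.e. the system $\dot x=A_Nx+B_Nu$ with observation matrix $C_N$, where $$A_N=\begin{pmatrix}0&I_N\\-\mathrm{diag}(\lambda_1,\dots,\lambda_N)&0\end{pmatrix}\in\mathbb{R}^{2N\times 2N},\quad B_N=(0,\dots,0,\phi_1(x_{\mathrm{con}}),\dots,\phi_N(x_{\mathrm{con}}))^{\top},\quad C_N=(\phi_1(x_{\mathrm{obs}}),\dots,\phi_N(x_{\mathrm{obs}}),0,\dots,0).$$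 For real matrices $A\in\mathbb{R}^{d\times d}$, $B\in\mathbb{R}^{d\times m}$, $C\in\mathbb{R}^{p\times d}$, let $\mathscr{L}^{0,+}(A)\subseteq\mathbb{R}^d$ be the space of real vectors in the span of the generalized eigenvectors of $A$ for eigenvalues with nonnegative real part, and let $D$ be the orthogonal projection of $\mathbb{R}^d$ onto $\left(\bigcap_{i=0}^{d-1}\ker(CA^i)\cap\mathscr{L}^{0,+}(A)\right)^{\perp}$. For $T>0$, $x_0\in\mathbb{R}^d$ and $z\in\mathbb{R}^p$, let $(u^T,x^T)$ be the optimal pair for the minimization of $$J^T(u)=\frac12\int_0^T\left[\|u(t)\|^2+\|Cx(t)-z\|^2\right]dt\quad\text{over }u\in L^2(0,T;\mathbb{R}^m),\qquad \dot x=Ax+Bu\text{ in }(0,T),\quad x(0)=x_0,$$ and let $(\overline u,\overline x)$ be any minimizer of $\frac12\left[\|u\|^2+\|Cx-z\|^2\right]$ under the constraint $Ax+Bu=0$. The triplet $(A,B,C)$ enjoys $C$-turnpike if there is $\mu>0$, depending only on $(A,B,C)$, such that for all $x_0\in\mathbb{R}^d$ and $z\in\mathbb{R}^p$ there is $K$,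 depending only on $(A,B,C,x_0,z)$, such that for every $T>0$ $$\|u^T(t)-\overline u\|+\|Dx^T(t)-D\overline x\|\le K\left[e^{-\mu t}+e^{-\mu(T-t)}\right]\qquad\text{for almost every }t\in[0,T].$$ Then $(A_N,B_N,C_N)$ enjoys $C_N$-turnpike if and only if, for every $i\in\{1,\dots,N\}$ with $\phi_i(x_{\mathrm{obs}})\neq 0$, one has $\phi_i(x_{\mathrm{con}})\neq 0$. -/

import Mathlib

open MeasureTheory Filter Topology Set
open scoped ContDiff

noncomputable section

/-! ### Finite-dimensional linear quadratic control -/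

/-- The linear map on Euclidean spaces given by a matrix. -/
abbrev matLin {ι κ : Type*} [Fintype ι] [DecidableEq ι] (M : Matrix κ ι ℝ) :
    EuclideanSpace ℝ ι →ₗ[ℝ] EuclideanSpace ℝ κ :=
  Matrix.toLpLin 2 2 M

/-- `x` is the (absolutely continuous) solution on `[0,T]` of `x' = A x + B u`, `x(0) = x₀`,
in integral form. -/
def IsTrajectory {ι m : Type*} [Fintype ι] [DecidableEq ι] [Fintype m] [DecidableEq m]
    (A : Matrix ι ι ℝ) (B : Matrix ι m ℝ) (T : ℝ) (x₀ : EuclideanSpace ℝ ι)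
    (u : ℝ → EuclideanSpace ℝ m) (x : ℝ → EuclideanSpace ℝ ι) : Prop :=
  ContinuousOn x (Icc 0 T) ∧
    ∀ t ∈ Icc (0 : ℝ) T, x t = x₀ + ∫ s in (0 : ℝ)..t, (matLin A (x s) + matLin B (u s))

/-- The evolution cost `J^T = 1/2 ∫₀ᵀ (‖u‖² + ‖C x - z‖²) dt`. -/
def evolutionCost {ι m p : Type*} [Fintype ι] [DecidableEq ι] [Fintype m] [Fintype p]
    (C : Matrix p ι ℝ) (T : ℝ) (z : EuclideanSpace ℝ p)
    (u : ℝ → EuclideanSpace ℝ m) (x : ℝ → EuclideanSpace ℝ ι) : ℝ :=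
  (1 / 2) * ∫ t in (0 : ℝ)..T, (‖u t‖ ^ 2 + ‖matLin C (x t) - z‖ ^ 2)

/-- `u ∈ L²(0,T)` and `x` is the corresponding state. -/
def IsAdmissiblePair {ι m : Type*} [Fintype ι] [DecidableEq ι] [Fintype m] [DecidableEq m]
    (A : Matrix ι ι ℝ) (B : Matrix ι m ℝ) (T : ℝ) (x₀ : EuclideanSpace ℝ ι)
    (u : ℝ → EuclideanSpace ℝ m) (x : ℝ → EuclideanSpace ℝ ι) : Prop :=
  MemLp u 2 (volume.restrict (Icc 0 T)) ∧ IsTrajectory A B T x₀ u x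

/-- `(u, x)` is an optimal pair of the evolution problem on `[0,T]` with initial datum `x₀` and
target `z`. -/
def IsOptimalPair {ι m p : Type*} [Fintype ι] [DecidableEq ι] [Fintype m] [DecidableEq m]
    [Fintype p] (A : Matrix ι ι ℝ) (B : Matrix ι m ℝ) (C : Matrix p ι ℝ) (T : ℝ)
    (x₀ : EuclideanSpace ℝ ι) (z : EuclideanSpace ℝ p)
    (u : ℝ → EuclideanSpace ℝ m) (x : ℝ → EuclideanSpace ℝ ι) : Prop :=
  IsAdmissiblePair A B T x₀ u x ∧
    ∀ v y, IsAdmissiblePair A B T x₀ v y → evolutionCost C T z u x ≤ evolutionCost C T z v y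

/-- The steady cost `J_s = 1/2 (‖u‖² + ‖C x - z‖²)`. -/
def steadyCost {ι m p : Type*} [Fintype ι] [DecidableEq ι] [Fintype m] [Fintype p]
    (C : Matrix p ι ℝ) (z : EuclideanSpace ℝ p)
    (u : EuclideanSpace ℝ m) (x : EuclideanSpace ℝ ι) : ℝ :=
  (1 / 2) * (‖u‖ ^ 2 + ‖matLin C x - z‖ ^ 2)

/-- `(u, x)` minimizes the steady cost under the constraint `0 = A x + B u`. -/
def IsSteadyMinimizer {ι m p : Type*} [Fintype ι] [DecidableEq ι] [Fintype m] [DecidableEq m]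
    [Fintype p] (A : Matrix ι ι ℝ) (B : Matrix ι m ℝ) (C : Matrix p ι ℝ)
    (z : EuclideanSpace ℝ p) (u : EuclideanSpace ℝ m) (x : EuclideanSpace ℝ ι) : Prop :=
  matLin A x + matLin B u = 0 ∧
    ∀ v y, matLin A y + matLin B v = 0 → steadyCost C z u x ≤ steadyCost C z v y

/-- The inclusion of `ℝ^ι` into `ℂ^ι`. -/
def complexify (ι : Type*) : EuclideanSpace ℝ ι →ₗ[ℝ] (ι → ℂ) where
  toFun x := fun i => (x i : ℂ)
  map_add' x y := by ext i; simp
  map_smul' c x := by ext i; simp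

/-- `𝓛^{0,+}(A)`: the real vectors in the span of the (complex) generalized eigenvectors of `A`
for the eigenvalues with nonnegative real part. -/
def nonstableSpace {ι : Type*} [Fintype ι] [DecidableEq ι] (A : Matrix ι ι ℝ) :
    Submodule ℝ (EuclideanSpace ℝ ι) :=
  ((⨆ μ : ℂ, ⨆ _ : 0 ≤ μ.re,
      Module.End.maxGenEigenspace (Matrix.toLin' (A.map Complex.ofReal)) μ).restrictScalars
        ℝ).comap (complexify ι)

/-- The unobservable space `⋂_{i < dim} ker (C A^i)`. -/
def unobservableSpace {ι p : Type*} [Fintype ι] [DecidableEq ι]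
    (A : Matrix ι ι ℝ) (C : Matrix p ι ℝ) : Submodule ℝ (EuclideanSpace ℝ ι) :=
  ⨅ i : Fin (Fintype.card ι), LinearMap.ker (matLin (C * A ^ (i : ℕ)))

/-- The undetectable space: unobservable modes which are not stable. -/
def undetectableSpace {ι p : Type*} [Fintype ι] [DecidableEq ι]
    (A : Matrix ι ι ℝ) (C : Matrix p ι ℝ) : Submodule ℝ (EuclideanSpace ℝ ι) :=
  unobservableSpace A C ⊓ nonstableSpace A

/-- The orthogonal projection `D` onto the detectable space, the orthogonal complement of the
undetectable space. -/
def detectableProj {ι p : Type*} [Fintype ι] [DecidableEq ι]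
    (A : Matrix ι ι ℝ) (C : Matrix p ι ℝ) : EuclideanSpace ℝ ι →L[ℝ] EuclideanSpace ℝ ι :=
  ((undetectableSpace A C)ᗮ).starProjection

/-- `C`-turnpike of the triplet `(A, B, C)`. The rate `μ` depends only on `(A, B, C)`, the constant
`K` moreover on `x₀` and `z`, and neither on the horizon `T`. The optimal control is an element of
`L²(0,T)`, so the estimate is required for almost every `t ∈ [0,T]`. -/
def CTurnpike {ι m p : Type*} [Fintype ι] [DecidableEq ι] [Fintype m] [DecidableEq m]
    [Fintype p] (A : Matrix ι ι ℝ) (B : Matrix ι m ℝ) (C : Matrix p ι ℝ) : Prop :=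
  ∃ μ : ℝ, 0 < μ ∧ ∀ (x₀ : EuclideanSpace ℝ ι) (z : EuclideanSpace ℝ p), ∃ K : ℝ,
    ∀ T : ℝ, 0 < T → ∀ u x, IsOptimalPair A B C T x₀ z u x →
      ∀ ub xb, IsSteadyMinimizer A B C z ub xb →
        ∀ᵐ t ∂(volume.restrict (Icc (0 : ℝ) T)),
          ‖u t - ub‖ + ‖detectableProj A C (x t) - detectableProj A C xb‖ ≤
            K * (Real.exp (-μ * t) + Real.exp (-μ * (T - t)))

/-! ### The Dirichlet Laplacian -/

/-- The boundary of `Ω` is `C^∞`: near each boundary point, `Ω` is a sublevel set of a smooth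
function with nonvanishing differential. -/
def HasSmoothBoundary {n : ℕ} (Ω : Set (EuclideanSpace ℝ (Fin n))) : Prop :=
  ∀ q ∈ frontier Ω, ∃ U : Set (EuclideanSpace ℝ (Fin n)), IsOpen U ∧ q ∈ U ∧
    ∃ ρ : EuclideanSpace ℝ (Fin n) → ℝ, ContDiffOn ℝ ∞ ρ U ∧
      (∀ x ∈ U, fderiv ℝ ρ x ≠ 0) ∧ Ω ∩ U = {x ∈ U | ρ x < 0}

/-- `ψ ∈ C_c^∞(Ω)`. -/
def IsTestFunction {n : ℕ} (Ω : Set (EuclideanSpace ℝ (Fin n)))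
    (ψ : EuclideanSpace ℝ (Fin n) → ℝ) : Prop :=
  ContDiff ℝ ∞ ψ ∧ HasCompactSupport ψ ∧ tsupport ψ ⊆ Ω

/-- `G` is the weak gradient of `f` on `Ω`. -/
def HasWeakGradient {n : ℕ} (Ω : Set (EuclideanSpace ℝ (Fin n)))
    (f : EuclideanSpace ℝ (Fin n) → ℝ)
    (G : EuclideanSpace ℝ (Fin n) → EuclideanSpace ℝ (Fin n)) : Prop :=
  ∀ ψ, IsTestFunction Ω ψ → ∀ v : EuclideanSpace ℝ (Fin n),
    ∫ x in Ω, f x * fderiv ℝ ψ x v = -∫ x in Ω, inner ℝ (G x) v * ψ x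

/-- `f ∈ H¹₀(Ω)` with weak gradient `G`: `f` and `G` are in `L²(Ω)`, and `f` is a limit in `H¹(Ω)`
of functions in `C_c^∞(Ω)`. -/
def MemH10 {n : ℕ} (Ω : Set (EuclideanSpace ℝ (Fin n)))
    (f : EuclideanSpace ℝ (Fin n) → ℝ)
    (G : EuclideanSpace ℝ (Fin n) → EuclideanSpace ℝ (Fin n)) : Prop :=
  MemLp f 2 (volume.restrict Ω) ∧ MemLp G 2 (volume.restrict Ω) ∧ HasWeakGradient Ω f G ∧
    ∃ ψ : ℕ → EuclideanSpace ℝ (Fin n) → ℝ, (∀ k, IsTestFunction Ω (ψ k)) ∧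
      Tendsto (fun k => eLpNorm (fun x => ψ k x - f x) 2 (volume.restrict Ω)) atTop (𝓝 0) ∧
      Tendsto (fun k => eLpNorm (fun x => gradient (ψ k) x - G x) 2 (volume.restrict Ω))
        atTop (𝓝 0)

/-- `f` is an eigenfunction of the Dirichlet Laplacian `-Δ : H¹₀(Ω) → H⁻¹(Ω)` with eigenvalue
`l`. -/
def IsDirichletEigenfunction {n : ℕ} (Ω : Set (EuclideanSpace ℝ (Fin n))) (l : ℝ)
    (f : EuclideanSpace ℝ (Fin n) → ℝ) : Prop :=
  ¬ f =ᵐ[volume.restrict Ω] 0 ∧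
    ∃ G, MemH10 Ω f G ∧ ∀ ψ, IsTestFunction Ω ψ →
      ∫ x in Ω, inner ℝ (G x) (gradient ψ x) = l * ∫ x in Ω, f x * ψ x

/-- The spectrum of the Dirichlet Laplacian is simple: its eigenspaces are one-dimensional. -/
def HasSimpleDirichletSpectrum {n : ℕ} (Ω : Set (EuclideanSpace ℝ (Fin n))) : Prop :=
  ∀ (l : ℝ) (f g : EuclideanSpace ℝ (Fin n) → ℝ), IsDirichletEigenfunction Ω l f →
    IsDirichletEigenfunction Ω l g → ∃ c : ℝ, g =ᵐ[volume.restrict Ω] fun x => c * f x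

/-! ### The projected wave equation
The first `N` eigenpairs are those with indices `0, …, N - 1`; the state consists of the `N`
position coefficients followed by the `N` velocity coefficients. -/

/-- `A_N = [0, I; -diag(λ), 0]`. -/
def waveA (N : ℕ) (lam : ℕ → ℝ) : Matrix (Fin N ⊕ Fin N) (Fin N ⊕ Fin N) ℝ :=
  Matrix.fromBlocks 0 1 (-(Matrix.diagonal fun i : Fin N => lam i)) 0

/-- `B_N = [0; φ_i(x_con)]`. -/
def waveB {n : ℕ} (N : ℕ) (φ : ℕ → EuclideanSpace ℝ (Fin n) → ℝ)
    (xcon : EuclideanSpace ℝ (Fin n)) : Matrix (Fin N ⊕ Fin N) (Fin 1) ℝ :=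
  Matrix.of fun j _ => Sum.elim (fun _ => 0) (fun i : Fin N => φ i xcon) j

/-- `C_N = [φ_i(x_obs), 0]`. -/
def waveC {n : ℕ} (N : ℕ) (φ : ℕ → EuclideanSpace ℝ (Fin n) → ℝ)
    (xobs : EuclideanSpace ℝ (Fin n)) : Matrix (Fin 1) (Fin N ⊕ Fin N) ℝ :=
  Matrix.of fun _ j => Sum.elim (fun i : Fin N => φ i xobs) (fun _ => 0) j

end

/-! Subtracting the steady extremal from the optimality system leaves the linear Hamiltonian flow
`waveHam`, with the state prescribed at time 0 and the costate at time `T`. Along it the pairing of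
state and costate decreases at the rate |Bᵀp|² + |Cx|². Oscillators with distinct frequencies are
independent on every interval (a Vandermonde argument), so if all control and observation
coefficients are nonzero, only the zero trajectory dissipates nothing on an interval. By compactness
the pairing then drops by a multiple of ‖w‖² per unit time. Being bounded by ‖state‖·‖costate‖, it
is controlled at both ends by the boundary data; its positive part decays forwards from 0 and its
negative part backwards from `T`. This is `IsDissipative.exists_bound`, and it avoids Riccati
equations.

All eigenvalues of the wave matrix are imaginary, so the detectable projection discards exactly the
unobserved modes. On such a mode the costate is a free oscillator with zero final data, hence it
vanishes and does not enter the control. The observed modes thus form a closed Hamiltonian system,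
to which the estimate applies when each of them is controlled (`cTurnpike_wave`). Conversely, an
observed mode that is not controlled conserves its energy, while the turnpike estimate with target 0
would make it small in the middle of a long interval (`not_cTurnpike_wave`).

The domain enters only through two facts: the eigenvalues are positive, and simplicity of the
spectrum makes them distinct. -/

/-! ### Linear flows and dissipation -/

section Flow

variable {W : Type*} [NormedAddCommGroup W] [NormedSpace ℝ W] [CompleteSpace W]

/-- The flow of the linear differential equation `w' = H w`. -/
noncomputable def linFlow (H : W →L[ℝ] W) (t : ℝ) : W →L[ℝ] W := NormedSpace.exp (t • H)

theorem linFlow_zero (H : W →L[ℝ] W) (w : W) : linFlow H 0 w = w := by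
  simp [linFlow]

theorem hasDerivAt_linFlow_apply (H : W →L[ℝ] W) (w : W) (t : ℝ) :
    HasDerivAt (fun t => linFlow H t w) (H (linFlow H t w)) t :=
  (hasDerivAt_exp_smul_const' H t).clm_apply (hasDerivAt_const t w) |>.congr_deriv (by
    simp [linFlow])

theorem continuous_linFlow (H : W →L[ℝ] W) : Continuous (linFlow H) :=
  (differentiable_exp_smul_const ℝ H).continuous

theorem eq_linFlow (H : W →L[ℝ] W) {Z : ℝ → W} (hZ : ∀ t, HasDerivAt Z (H (Z t)) t) (t : ℝ) :
    Z t = linFlow H t (Z 0) := by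
  have := ODE_solution_unique_univ (v := fun _ => H) (s := fun _ => univ) (K := ‖H‖₊) (t₀ := 0)
    (f := Z) (g := fun t => linFlow H t (Z 0)) (fun t => H.lipschitz.lipschitzOnWith)
    (fun t => ⟨hZ t, mem_univ _⟩) (fun t => ⟨hasDerivAt_linFlow_apply H _ t, mem_univ _⟩)
    (by simp [linFlow_zero])
  exact congrFun this t

theorem linFlow_add (H : W →L[ℝ] W) (s t : ℝ) (w : W) :
    linFlow H (t + s) w = linFlow H t (linFlow H s w) := by
  have h : ∀ t, HasDerivAt (fun t => linFlow H (t + s) w) (H (linFlow H (t + s) w)) t := fun t =>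
    (hasDerivAt_linFlow_apply H w (t + s)).comp_add_const t s
  simpa using eq_linFlow H h t

theorem linFlow_injective (H : W →L[ℝ] W) (t : ℝ) : Function.Injective (linFlow H t) := by
  intro x y hxy
  have := congrArg (linFlow H (-t)) hxy
  simpa [← linFlow_add, linFlow_zero] using this

end Flow

/-- `h` is a quadratic Lyapunov function for `w' = H w` with dissipation rate `ρ`, and only the
zero trajectory has vanishing dissipation on some interval. -/
structure IsDissipative {W : Type*} [NormedAddCommGroup W] [NormedSpace ℝ W] [CompleteSpace W]
    (H : W →L[ℝ] W) (h ρ : W → ℝ) : Prop where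
  continuous : Continuous h
  map_smul : ∀ (a : ℝ) w, h (a • w) = a ^ 2 * h w
  nonneg : ∀ w, 0 ≤ ρ w
  hasDerivAt : ∀ w t, HasDerivAt (fun t => h (linFlow H t w)) (-ρ (linFlow H t w)) t
  observable : ∀ w ε, 0 < ε → (∀ t ∈ Ioo 0 ε, ρ (linFlow H t w) = 0) → w = 0

/-- Compactness of the unit sphere and homogeneity of degree two. The sphere may be empty: the phase
space is trivial when no mode is observed. -/
theorem exists_pos_mul_norm_sq_le {W : Type*} [NormedAddCommGroup W] [NormedSpace ℝ W]
    [FiniteDimensional ℝ W] {F : W → ℝ} (hF : Continuous F)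
    (hsmul : ∀ (a : ℝ) w, F (a • w) = a ^ 2 * F w) (hpos : ∀ w, w ≠ 0 → 0 < F w) :
    ∃ α, 0 < α ∧ ∀ w, α * ‖w‖ ^ 2 ≤ F w := by
  have : ProperSpace W := FiniteDimensional.proper ℝ W
  obtain ⟨α, hα, hle⟩ := (isCompact_sphere (0 : W) 1).exists_forall_le' (a := 0) hF.continuousOn
    (fun w hw => hpos w (by rintro rfl; simp at hw))
  refine ⟨α, hα, fun w => ?_⟩
  rcases eq_or_ne w 0 with rfl | hw
  · have := hsmul 0 0
    simp_all
  · have hn : ‖w‖ ≠ 0 := norm_ne_zero_iff.2 hw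
    have h1 := hle (‖w‖⁻¹ • w) (by simp [norm_smul, hn])
    have h2 := hsmul ‖w‖ (‖w‖⁻¹ • w)
    rw [smul_inv_smul₀ hn] at h2
    rw [h2, mul_comm]
    gcongr

/-- A nonincreasing function that loses a fixed proportion of its modulus per unit time decays
exponentially as long as it is positive. -/
theorem le_max_mul_exp_of_antitone {g : ℝ → ℝ} {κ : ℝ} (hκ : κ < 1) (hg : Antitone g)
    (hdec : ∀ t, g (t + 1) ≤ g t - κ * |g t|) {t : ℝ} (ht : 0 ≤ t) :
    g t ≤ max (g 0) 0 * Real.exp (Real.log (1 - κ) * (⌊t⌋₊ : ℝ)) := by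
  -- While `g n` is nonnegative each step multiplies the bound by `1 - κ`; once it is nonpositive,
  -- monotonicity keeps it below the nonnegative right-hand side.
  have key : ∀ n : ℕ, g n ≤ max (g 0) 0 * (1 - κ) ^ n := by
    intro n
    induction n with
    | zero => simp
    | succ n ih =>
      have h0 : 0 ≤ max (g 0) 0 * (1 - κ) ^ (n + 1) :=
        mul_nonneg (le_max_right _ _) (pow_nonneg (by linarith) _)
      have h1 := hdec n
      push_cast
      rcases le_total 0 (g n) with h | h
      · rw [abs_of_nonneg h] at h1
        rw [pow_succ, ← mul_assoc]
        nlinarith [mul_le_mul_of_nonneg_right ih (by linarith : 0 ≤ 1 - κ)]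
      · exact (hg (by linarith : (n : ℝ) ≤ n + 1)).trans (h.trans h0)
  have h2 := (hg (Nat.floor_le ht)).trans (key ⌊t⌋₊)
  rwa [mul_comm (Real.log _), Real.exp_nat_mul, Real.exp_log (by linarith)]

theorem le_max_mul_exp_of_antitone' {g : ℝ → ℝ} {κ : ℝ} (h0 : 0 ≤ κ) (hκ : κ < 1)
    (hg : Antitone g) (hdec : ∀ t, g (t + 1) ≤ g t - κ * |g t|) {t : ℝ} (ht : 0 ≤ t) :
    g t ≤ max (g 0) 0 * Real.exp (Real.log (1 - κ) * (t - 1)) := by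
  refine (le_max_mul_exp_of_antitone hκ hg hdec ht).trans ?_
  have h1 : Real.log (1 - κ) ≤ 0 := Real.log_nonpos (by linarith) (by linarith)
  have h2 : t - 1 ≤ ⌊t⌋₊ := by linarith [Nat.lt_floor_add_one t]
  exact mul_le_mul_of_nonneg_left (Real.exp_le_exp.2 (mul_le_mul_of_nonpos_left h2 h1))
    (le_max_right _ _)

namespace IsDissipative

section

variable {W : Type*} [NormedAddCommGroup W] [NormedSpace ℝ W] [CompleteSpace W]
  {H : W →L[ℝ] W} {h ρ : W → ℝ}

theorem antitone (hd : IsDissipative H h ρ) (w : W) : Antitone fun t => h (linFlow H t w) :=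
  antitone_of_hasDerivAt_nonpos (hd.hasDerivAt w) fun t => neg_nonpos.2 (hd.nonneg _)

/-- A nonincreasing function that does not drop between the endpoints is constant, so the
dissipation vanishes in between and observability applies. -/
theorem eq_zero_of_le (hd : IsDissipative H h ρ) {w : W} {T : ℝ} (hT : 0 < T)
    (hle : h w ≤ h (linFlow H T w)) : w = 0 := by
  refine hd.observable w T hT fun t ht => ?_
  have hc : ∀ s ∈ Ioo 0 T, h (linFlow H s w) = h w := fun s hs => le_antisymm
    (by simpa [linFlow_zero] using hd.antitone w hs.1.le) (hle.trans (hd.antitone w hs.2.le))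
  have h1 : HasDerivAt (fun t => h (linFlow H t w)) 0 t :=
    (hasDerivAt_const t (h w)).congr_of_eventuallyEq
      (by filter_upwards [Ioo_mem_nhds ht.1 ht.2] with s hs using hc s hs)
  simpa using (hd.hasDerivAt w t).unique h1

end

section

variable {W : Type*} [NormedAddCommGroup W] [NormedSpace ℝ W] [FiniteDimensional ℝ W]
  [CompleteSpace W] {H : W →L[ℝ] W} {h ρ : W → ℝ}

/-- The drop of `h` over unit time is a continuous form of degree two, positive off zero. The bound
by the initial norm serves windows to the right of a time, the bound by the final norm windows to
its left. -/
theorem exists_dissipation_bound (hd : IsDissipative H h ρ) :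
    ∃ α, 0 < α ∧ ∀ w, α * ‖w‖ ^ 2 ≤ h w - h (linFlow H 1 w) ∧
      α * ‖linFlow H 1 w‖ ^ 2 ≤ h w - h (linFlow H 1 w) := by
  obtain ⟨α, hα, hle⟩ := exists_pos_mul_norm_sq_le
    (F := fun w => h w - h (linFlow H 1 w))
    (hd.continuous.sub (hd.continuous.comp (linFlow H 1).continuous))
    (fun a w => by simp [hd.map_smul]; ring)
    (fun w hw => by
      by_contra hcon
      exact hw (hd.eq_zero_of_le one_pos (by linarith)))
  -- Adding 1 gives `1 ≤ M`, so that `α / M ^ 2` works in both bounds.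
  set M := ‖linFlow H 1‖ + 1 with hM
  have hM1 : 1 ≤ M := by simp [hM]
  have hMpos : 0 < M := by linarith
  have hM2 : 1 ≤ M ^ 2 := one_le_pow₀ hM1
  refine ⟨α / M ^ 2, by positivity, fun w => ⟨?_, ?_⟩⟩
  · refine le_trans ?_ (hle w)
    gcongr
    exact div_le_self hα.le hM2
  · refine le_trans ?_ (hle w)
    have h1 : ‖linFlow H 1 w‖ ≤ M * ‖w‖ :=
      ((linFlow H 1).le_opNorm w).trans (by gcongr; simp [hM])
    calc α / M ^ 2 * ‖linFlow H 1 w‖ ^ 2 ≤ α / M ^ 2 * (M * ‖w‖) ^ 2 := by gcongr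
      _ = α * ‖w‖ ^ 2 := by field_simp

end

end IsDissipative

/-! ### Estimates from two-point boundary data on a product of state and costate spaces -/

namespace IsDissipative

variable {V : Type*} [NormedAddCommGroup V] [NormedSpace ℝ V] [FiniteDimensional ℝ V]
  [CompleteSpace V] {H : V × V →L[ℝ] V × V} {h ρ : V × V → ℝ}

/-- If the first component vanishes at 0 and the second at `T`, then `h` is zero at both ends and
the trajectory is trivial; for `T = 0` this is immediate. Compactness in `(T, w)` makes the bound
uniform over short horizons. -/
theorem exists_boundary_bound (hd : IsDissipative H h ρ) (S : ℝ)
    (h1 : ∀ w, w.1 = 0 → h w = 0) (h2 : ∀ w, w.2 = 0 → h w = 0) :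
    ∃ β, 0 < β ∧ ∀ T ∈ Icc 0 S, ∀ w, β * ‖w‖ ≤ ‖w.1‖ + ‖(linFlow H T w).2‖ := by
  have : ProperSpace (V × V) := FiniteDimensional.proper ℝ _
  have hcont : Continuous fun z : ℝ × (V × V) => ‖z.2.1‖ + ‖(linFlow H z.1 z.2).2‖ := by
    have := continuous_linFlow H
    fun_prop
  obtain ⟨β, hβ, hle⟩ := (isCompact_Icc (a := (0 : ℝ)) (b := S)).prod
    (isCompact_sphere (0 : V × V) 1) |>.exists_forall_le' (a := 0) hcont.continuousOn (by
      rintro ⟨T, w⟩ ⟨hT, hw⟩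
      by_contra hcon
      have hw1 : w.1 = 0 := norm_le_zero_iff.1
        (by linarith [norm_nonneg (linFlow H T w).2, norm_nonneg w.1])
      have hw2 : (linFlow H T w).2 = 0 := norm_le_zero_iff.1
        (by linarith [norm_nonneg (linFlow H T w).2, norm_nonneg w.1])
      have hw0 : w = 0 := by
        rcases hT.1.eq_or_lt with h0 | h0
        · simp only at h0
          rw [← h0, linFlow_zero] at hw2
          exact Prod.ext hw1 hw2
        · exact hd.eq_zero_of_le h0 (by rw [h1 w hw1, h2 _ hw2])
      simp [hw0] at hw)
  refine ⟨β, hβ, fun T hT w => ?_⟩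
  rcases eq_or_ne w 0 with rfl | hw
  · simp
  · have hn : ‖w‖ ≠ 0 := norm_ne_zero_iff.2 hw
    have h3 := hle (T, ‖w‖⁻¹ • w) ⟨hT, by simp [norm_smul, hn]⟩
    simp only [_root_.map_smul, Prod.smul_fst, Prod.smul_snd, norm_smul, norm_inv, norm_norm,
      ← mul_add] at h3
    rwa [inv_mul_eq_div, le_div_iff₀ (norm_pos_iff.2 hw)] at h3

/-- Exponential decay away from both ends of a long time interval. -/
theorem exists_bound_of_two_le (hd : IsDissipative H h ρ) {M : ℝ} (hM : 0 < M)
    (h1 : ∀ w, |h w| ≤ M * ‖w.1‖ * ‖w‖) (h2 : ∀ w, |h w| ≤ M * ‖w.2‖ * ‖w‖) :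
    ∃ μ, 0 < μ ∧ ∃ C, 0 ≤ C ∧ ∀ T, 2 ≤ T → ∀ w a, ‖w.1‖ ≤ a → ‖(linFlow H T w).2‖ ≤ a →
      ∀ t ∈ Icc 0 T, ‖linFlow H t w‖ ≤
        C * a * (Real.exp (-μ * t) + Real.exp (-μ * (T - t))) := by
  obtain ⟨α, hα, hdis⟩ := hd.exists_dissipation_bound
  -- As |h| ≤ M‖w‖², the drop α‖w‖² is at least κ|h|. The minimum with 1/2 keeps the logarithm of `1
  -- - κ` meaningful.
  obtain ⟨κ, hκ0, hκ1, hκα⟩ : ∃ κ, 0 < κ ∧ κ < 1 ∧ κ * M ≤ α :=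
    ⟨min (α / M) (1 / 2), by positivity, (min_le_right _ _).trans_lt (by norm_num), by
      calc _ ≤ α / M * M := by gcongr; exact min_le_left _ _
        _ = α := by field_simp⟩
  have hκh : ∀ w, κ * |h w| ≤ α * ‖w‖ ^ 2 := fun w => by
    calc κ * |h w| ≤ κ * (M * ‖w.1‖ * ‖w‖) := by gcongr; exact h1 w
      _ ≤ κ * (M * ‖w‖ * ‖w‖) := by gcongr; exact norm_fst_le w
      _ = κ * M * ‖w‖ ^ 2 := by ring
      _ ≤ α * ‖w‖ ^ 2 := by gcongr
  set ν := -Real.log (1 - κ) with hν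
  have hνpos : 0 < ν := neg_pos.2 (Real.log_neg (by linarith) (by linarith))
  set G := 4 * M ^ 2 / α with hG
  have hGpos : 0 < G := by positivity
  -- The squared norm decays at rate `ν`; the square root halves the rate.
  refine ⟨ν / 2, by positivity, √(G * Real.exp (2 * ν) / α), by positivity, ?_⟩
  intro T hT w a ha1 ha2 t ht
  have ha : 0 ≤ a := (norm_nonneg _).trans ha1
  set g : ℝ → ℝ := fun t => h (linFlow H t w) with hg
  have hganti : Antitone g := hd.antitone w
  have hstep : ∀ t, linFlow H (t + 1) w = linFlow H 1 (linFlow H t w) := fun t => by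
    rw [add_comm, linFlow_add]
  have hfwd : ∀ t, α * ‖linFlow H t w‖ ^ 2 ≤ g t - g (t + 1) := fun t => by
    simpa only [hg, hstep] using (hdis (linFlow H t w)).1
  have hbwd : ∀ t, α * ‖linFlow H (t + 1) w‖ ^ 2 ≤ g t - g (t + 1) := fun t => by
    simpa only [hg, hstep] using (hdis (linFlow H t w)).2
  -- With `x`, `y` the norms at the two ends, the total drop dominates both αx² and αy² and is at
  -- most Ma(x + y), because one component at each end is bounded by `a`. Hence α(x + y) ≤ 4Ma,
  -- which explains `G`.
  have hbd : max (g 0) 0 ≤ G * a ^ 2 ∧ max (-g T) 0 ≤ G * a ^ 2 := by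
    set x := ‖w‖ with hx
    set y := ‖linFlow H T w‖ with hy
    have hx0 : 0 ≤ x := norm_nonneg _
    have hy0 : 0 ≤ y := norm_nonneg _
    have e1 : α * x ^ 2 ≤ g 0 - g T := by
      have := hfwd 0
      rw [linFlow_zero] at this
      linarith [hganti (by linarith : (0 : ℝ) + 1 ≤ T)]
    have e2 : α * y ^ 2 ≤ g 0 - g T := by
      have := hbwd (T - 1)
      rw [sub_add_cancel] at this
      linarith [hganti (by linarith : (0 : ℝ) ≤ T - 1)]
    have e3 : |g 0| ≤ M * a * x := by
      have := h1 w
      simp only [hg, linFlow_zero]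
      exact this.trans (by gcongr)
    have e4 : |g T| ≤ M * a * y := (h2 _).trans (by gcongr)
    have e5 : α * (x + y) ≤ 4 * M * a := by
      rcases (add_nonneg hx0 hy0).eq_or_lt with h0 | h0
      · rw [← h0, mul_zero]; positivity
      · refine le_of_mul_le_mul_right ?_ h0
        nlinarith [le_abs_self (g 0), neg_abs_le (g T), mul_nonneg hα.le (sq_nonneg (x - y))]
    have e6 : M * a * (x + y) ≤ G * a ^ 2 := by
      rw [hG, div_mul_eq_mul_div, le_div_iff₀ hα]
      calc M * a * (x + y) * α = M * a * (α * (x + y)) := by ring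
        _ ≤ M * a * (4 * M * a) := by gcongr
        _ = _ := by ring
    have hMa : 0 ≤ M * a := by positivity
    refine ⟨max_le ?_ (by positivity), max_le ?_ (by positivity)⟩
    · nlinarith [le_abs_self (g 0), mul_nonneg hMa hy0]
    · nlinarith [neg_abs_le (g T), mul_nonneg hMa hx0]
  have hup : ∀ t, 0 ≤ t → g t ≤ G * a ^ 2 * Real.exp (-ν * (t - 1)) := fun t ht => by
    refine (le_max_mul_exp_of_antitone' hκ0.le hκ1 hganti (fun t => ?_) ht).trans ?_
    · linarith [hfwd t, hκh (linFlow H t w)]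
    · rw [hν, neg_neg]
      gcongr
      exact hbd.1
  -- Time reversal: s ↦ -g(T - s) is again nonincreasing, and loses a fixed proportion by the
  -- backward form of the dissipation bound.
  have hlo : ∀ t, t ≤ T → -g t ≤ G * a ^ 2 * Real.exp (-ν * (T - t - 1)) := fun t ht => by
    have := le_max_mul_exp_of_antitone' (g := fun s => -g (T - s)) (t := T - t) hκ0.le hκ1
      (fun _ _ _ => neg_le_neg (hganti (by linarith))) (fun s => ?_) (by linarith)
    · simp only [sub_sub_cancel, sub_zero] at this
      refine this.trans ?_
      rw [hν, neg_neg]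
      gcongr
      exact hbd.2
    · have h3 := hbwd (T - (s + 1))
      rw [show T - (s + 1) + 1 = T - s by ring] at h3
      have := hκh (linFlow H (T - s) w)
      simp only [abs_neg]
      linarith
  have hE : ∀ x y : ℝ, x ≤ y → Real.exp (-ν * y) ≤ Real.exp (-ν * x) := fun x y hxy =>
    Real.exp_le_exp.2 (by nlinarith)
  have hshift : ∀ x, Real.exp (-ν * (x - 2)) = Real.exp (2 * ν) * Real.exp (-ν * x) := fun x => by
    rw [← Real.exp_add]; ring_nf
  have hmain : α * ‖linFlow H t w‖ ^ 2 ≤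
      G * a ^ 2 * (Real.exp (2 * ν) * (Real.exp (-ν * t) + Real.exp (-ν * (T - t)))) := by
    rw [mul_add, ← hshift, ← hshift]
    have hGa : 0 ≤ G * a ^ 2 := by positivity
    -- The unit window is taken to the right of `t` if it fits, otherwise to the left, where `2 ≤ T`
    -- ensures `t - 1 ≥ 0`. The drop over it is at most the positive part at its left end plus the
    -- negative part at its right end; the shift by 2 absorbs the window length.
    rcases le_total (t + 1) T with h3 | h3
    · have e1 := hup t ht.1
      have e2 := hlo (t + 1) h3
      have e3 := mul_le_mul_of_nonneg_left (hE (t - 2) (t - 1) (by linarith)) hGa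
      have e4 := mul_le_mul_of_nonneg_left
        (hE (T - t - 2) (T - (t + 1) - 1) (by linarith)) hGa
      linarith [hfwd t]
    · have e1 := hup (t - 1) (by linarith)
      have e2 := hlo t ht.2
      have e3 := mul_le_mul_of_nonneg_left (hE (t - 2) (t - 1 - 1) (by linarith)) hGa
      have e4 := mul_le_mul_of_nonneg_left (hE (T - t - 2) (T - t - 1) (by linarith)) hGa
      have e5 := hbwd (t - 1)
      rw [sub_add_cancel] at e5
      linarith
  refine le_of_sq_le_sq ?_ (by positivity)
  have hsq : ∀ x, Real.exp (-(ν / 2) * x) ^ 2 = Real.exp (-ν * x) := fun x => by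
    rw [← Real.exp_nat_mul]; congr 1; push_cast; ring
  have h4 : Real.exp (-ν * t) + Real.exp (-ν * (T - t)) ≤
      (Real.exp (-(ν / 2) * t) + Real.exp (-(ν / 2) * (T - t))) ^ 2 := by
    rw [add_sq, hsq, hsq]
    have : 0 ≤ 2 * Real.exp (-(ν / 2) * t) * Real.exp (-(ν / 2) * (T - t)) := by positivity
    linarith
  calc ‖linFlow H t w‖ ^ 2
      ≤ G * a ^ 2 * (Real.exp (2 * ν) * (Real.exp (-ν * t) + Real.exp (-ν * (T - t)))) / α := by
        rw [le_div_iff₀ hα]; linarith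
    _ = G * Real.exp (2 * ν) / α * a ^ 2 * (Real.exp (-ν * t) + Real.exp (-ν * (T - t))) := by
        ring
    _ ≤ G * Real.exp (2 * ν) / α * a ^ 2 *
        (Real.exp (-(ν / 2) * t) + Real.exp (-(ν / 2) * (T - t))) ^ 2 := by gcongr
    _ = _ := by
        rw [mul_pow, mul_pow, Real.sq_sqrt (by positivity)]

/-- Exponential decay away from both ends of a time interval, uniformly in its length. -/
theorem exists_bound (hd : IsDissipative H h ρ) {M : ℝ} (hM : 0 < M)
    (h1 : ∀ w, |h w| ≤ M * ‖w.1‖ * ‖w‖) (h2 : ∀ w, |h w| ≤ M * ‖w.2‖ * ‖w‖) :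
    ∃ μ, 0 < μ ∧ ∃ C, 0 ≤ C ∧ ∀ T, 0 < T → ∀ w a, ‖w.1‖ ≤ a → ‖(linFlow H T w).2‖ ≤ a →
      ∀ t ∈ Icc 0 T, ‖linFlow H t w‖ ≤
        C * a * (Real.exp (-μ * t) + Real.exp (-μ * (T - t))) := by
  obtain ⟨μ, hμ, C, hC, hlong⟩ := hd.exists_bound_of_two_le hM h1 h2
  obtain ⟨β, hβ, hbdry⟩ := hd.exists_boundary_bound 2
    (fun w hw => by simpa [hw] using h1 w) (fun w hw => by simpa [hw] using h2 w)
  obtain ⟨B, hB⟩ := (isCompact_Icc (a := (0 : ℝ)) (b := 2)).exists_bound_of_continuousOn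
    (continuous_linFlow H).continuousOn
  have hB0 : 0 ≤ B := (norm_nonneg _).trans (hB 0 (by simp))
  refine ⟨μ, hμ, C + B * (2 / β) * Real.exp (2 * μ), by positivity, ?_⟩
  intro T hT w a ha1 ha2 t ht
  have ha : 0 ≤ a := (norm_nonneg _).trans ha1
  rcases le_total 2 T with h2T | hT2
  · refine (hlong T h2T w a ha1 ha2 t ht).trans ?_
    gcongr
    have : 0 ≤ B * (2 / β) * Real.exp (2 * μ) := by positivity
    linarith
  · have e1 : ‖w‖ ≤ 2 / β * a := by
      rw [div_mul_eq_mul_div, le_div_iff₀ hβ]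
      linarith [hbdry T ⟨hT.le, hT2⟩ w]
    have e2 : ‖linFlow H t w‖ ≤ B * (2 / β * a) :=
      ((linFlow H t).le_opNorm w).trans
        (mul_le_mul (hB t ⟨ht.1, ht.2.trans hT2⟩) e1 (norm_nonneg _) hB0)
    -- On horizons of length at most 2 nothing needs to decay: the factor e^{2μ} compensates the
    -- weight, since `t ≤ 2`.
    have e3 : 1 ≤ Real.exp (2 * μ) * (Real.exp (-μ * t) + Real.exp (-μ * (T - t))) := by
      rw [mul_add, ← Real.exp_add]
      have : 1 ≤ Real.exp (2 * μ + -μ * t) := Real.one_le_exp (by nlinarith [ht.2])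
      have : 0 ≤ Real.exp (2 * μ) * Real.exp (-μ * (T - t)) := by positivity
      linarith
    calc ‖linFlow H t w‖ ≤ B * (2 / β * a) * 1 := by linarith
      _ ≤ B * (2 / β * a) *
          (Real.exp (2 * μ) * (Real.exp (-μ * t) + Real.exp (-μ * (T - t)))) := by gcongr
      _ = B * (2 / β) * Real.exp (2 * μ) * a *
          (Real.exp (-μ * t) + Real.exp (-μ * (T - t))) := by ring
      _ ≤ _ := by
        gcongr
        linarith

end IsDissipative

/-! ### The Hamiltonian system of the projected wave equation -/

/-- Invertibility of the Vandermonde matrix. Only as many moments as nodes are used, which matches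
the finite range of powers in the unobservable space. -/
theorem eq_zero_of_forall_sum_mul_pow_eq_zero {ι : Type*} [Fintype ι] {f v : ι → ℝ}
    (hf : Function.Injective f)
    (hfv : ∀ k < Fintype.card ι, ∑ j, v j * f j ^ k = 0) : v = 0 := by
  let e := Fintype.equivFin ι
  have h := Matrix.eq_zero_of_forall_pow_sum_mul_pow_eq_zero (f := f ∘ e.symm) (v := v ∘ e.symm)
    (hf.comp e.symm.injective) (fun i => by
      rw [← hfv i i.2]
      exact Fintype.sum_equiv e.symm _ _ (fun _ => rfl))
  ext i
  simpa using congrFun h (e i)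

theorem HasDerivAt.eq_zero_of_eqOn_Ioo {f : ℝ → ℝ} {f' a b t : ℝ} (hf : HasDerivAt f f' t)
    (ht : t ∈ Ioo a b) (h0 : ∀ s ∈ Ioo a b, f s = 0) : f' = 0 :=
  hf.unique ((hasDerivAt_const t (0 : ℝ)).congr_of_eventuallyEq
    (by filter_upwards [Ioo_mem_nhds ht.1 ht.2] with s hs using h0 s hs))

/-- Harmonic oscillators with distinct frequencies are linearly independent over every interval. -/
theorem oscillators_eq_zero {ι : Type*} [Fintype ι] {lam a : ι → ℝ} {x y : ℝ}
    (hlam : Function.Injective lam) {f g : ℝ → ι → ℝ}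
    (hf : ∀ t ∈ Ioo x y, ∀ i, HasDerivAt (fun t => f t i) (g t i) t)
    (hg : ∀ t ∈ Ioo x y, ∀ i, HasDerivAt (fun t => g t i) (-(lam i * f t i)) t)
    (h0 : ∀ t ∈ Ioo x y, ∑ i, a i * f t i = 0) :
    ∀ t ∈ Ioo x y, ∀ i, a i * f t i = 0 ∧ a i * g t i = 0 := by
  -- Differentiating the relation twice multiplies each coefficient by -λ_i, so all moments in the
  -- λ_i vanish and the Vandermonde argument separates the modes.
  have key : ∀ k : ℕ, ∀ t ∈ Ioo x y,
      ∑ i, a i * f t i * lam i ^ k = 0 ∧ ∑ i, a i * g t i * lam i ^ k = 0 := by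
    intro k
    have step : (∀ t ∈ Ioo x y, ∑ i, a i * f t i * lam i ^ k = 0) →
        ∀ t ∈ Ioo x y, ∑ i, a i * g t i * lam i ^ k = 0 := fun hz t ht =>
      HasDerivAt.eq_zero_of_eqOn_Ioo (HasDerivAt.fun_sum fun i _ =>
        ((hf t ht i).const_mul (a i)).mul_const (lam i ^ k)) ht hz
    induction k with
    | zero => exact fun t ht => ⟨by simpa using h0 t ht, step (by simpa using h0) t ht⟩
    | succ k ih =>
      have hz : ∀ t ∈ Ioo x y, ∑ i, a i * f t i * lam i ^ (k + 1) = 0 := fun t ht => by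
        have := HasDerivAt.eq_zero_of_eqOn_Ioo (HasDerivAt.fun_sum fun i _ =>
          ((hg t ht i).const_mul (a i)).mul_const (lam i ^ k)) ht (fun s hs => (ih
            (fun hz t ht => HasDerivAt.eq_zero_of_eqOn_Ioo (HasDerivAt.fun_sum fun i _ =>
              ((hf t ht i).const_mul (a i)).mul_const (lam i ^ k)) ht hz) s hs).2)
        rw [← neg_eq_zero, ← Finset.sum_neg_distrib, ← this]
        exact Finset.sum_congr rfl fun i _ => by ring
      exact fun t ht => ⟨hz t ht, step hz t ht⟩
  intro t ht i
  exact ⟨congrFun (eq_zero_of_forall_sum_mul_pow_eq_zero (v := fun i => a i * f t i) hlam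
      fun k _ => (key k t ht).1) i,
    congrFun (eq_zero_of_forall_sum_mul_pow_eq_zero (v := fun i => a i * g t i) hlam
      fun k _ => (key k t ht).2) i⟩

theorem eq_of_hasDerivAt_eq_zero_Ioo {f f' : ℝ → ℝ} {a b : ℝ} (hab : a < b)
    (hf : ∀ t, HasDerivAt f (f' t) t) (h0 : ∀ t ∈ Ioo a b, f' t = 0) : f a = f b := by
  obtain ⟨c, hc, he⟩ := exists_hasDerivAt_eq_slope f f' hab
    (fun t _ => (hf t).continuousAt.continuousWithinAt) (fun t _ => hf t)
  rw [h0 c hc, eq_comm, div_eq_zero_iff] at he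
  rcases he with he | he <;> linarith

section WaveHamiltonian

variable {ι : Type*} [Fintype ι]

/-- Position and velocity coefficients, or the corresponding costates. -/
abbrev WavePhase (ι : Type*) := (ι → ℝ) × (ι → ℝ)

/-- The Hamiltonian field of the linear quadratic problem for oscillators with squared
frequencies `lam`, control coefficients `b` and observation coefficients `c`. -/
noncomputable def waveHam (lam b c : ι → ℝ) :
    WavePhase ι × WavePhase ι →L[ℝ] WavePhase ι × WavePhase ι :=
  LinearMap.toContinuousLinearMap
    { toFun := fun w => ((w.1.2, fun i => -(lam i * w.1.1 i) - b i * ∑ j, b j * w.2.2 j),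
        (fun i => lam i * w.2.2 i - c i * ∑ j, c j * w.1.1 j, fun i => -w.2.1 i))
      map_add' := fun w z => by
        ext i <;> simp [mul_add, Finset.sum_add_distrib] <;> ring
      map_smul' := fun a w => by
        ext i <;> simp [mul_left_comm _ a, ← Finset.mul_sum] <;> ring }

/-- The duality pairing of state and costate. -/
def wavePairing (w : WavePhase ι × WavePhase ι) : ℝ :=
  ∑ i, (w.1.1 i * w.2.1 i + w.1.2 i * w.2.2 i)

/-- The rate at which the pairing decreases along Hamiltonian trajectories. -/
def waveDissipation (b c : ι → ℝ) (w : WavePhase ι × WavePhase ι) : ℝ :=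
  (∑ j, b j * w.2.2 j) ^ 2 + (∑ j, c j * w.1.1 j) ^ 2

variable {lam b c : ι → ℝ}

theorem waveHam_apply (w : WavePhase ι × WavePhase ι) :
    waveHam lam b c w = ((w.1.2, fun i => -(lam i * w.1.1 i) - b i * ∑ j, b j * w.2.2 j),
      (fun i => lam i * w.2.2 i - c i * ∑ j, c j * w.1.1 j, fun i => -w.2.1 i)) := rfl

/-- The four coordinate equations of a Hamiltonian trajectory. -/
theorem hasDerivAt_waveHam_iff {Z : ℝ → WavePhase ι × WavePhase ι} {t : ℝ} :
    HasDerivAt Z (waveHam lam b c (Z t)) t ↔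
      ∀ i, HasDerivAt (fun t => (Z t).1.1 i) ((Z t).1.2 i) t ∧
        HasDerivAt (fun t => (Z t).1.2 i)
          (-(lam i * (Z t).1.1 i) - b i * ∑ j, b j * (Z t).2.2 j) t ∧
        HasDerivAt (fun t => (Z t).2.1 i)
          (lam i * (Z t).2.2 i - c i * ∑ j, c j * (Z t).1.1 j) t ∧
        HasDerivAt (fun t => (Z t).2.2 i) (-(Z t).2.1 i) t := by
  rw [waveHam_apply]
  constructor
  · intro h i
    have h1 := h.fst
    have h2 := h.snd
    exact ⟨hasDerivAt_pi.1 h1.fst i, hasDerivAt_pi.1 h1.snd i, hasDerivAt_pi.1 h2.fst i,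
      hasDerivAt_pi.1 h2.snd i⟩
  · intro h
    exact ((hasDerivAt_pi.2 fun i => (h i).1).prodMk (hasDerivAt_pi.2 fun i => (h i).2.1)).prodMk
      ((hasDerivAt_pi.2 fun i => (h i).2.2.1).prodMk (hasDerivAt_pi.2 fun i => (h i).2.2.2))

/-- The contributions of A and Aᵀ cancel; only the control and observation squares survive. -/
theorem hasDerivAt_wavePairing (w : WavePhase ι × WavePhase ι) (t : ℝ) :
    HasDerivAt (fun t => wavePairing (linFlow (waveHam lam b c) t w))
      (-waveDissipation b c (linFlow (waveHam lam b c) t w)) t := by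
  have h := hasDerivAt_waveHam_iff.1 (hasDerivAt_linFlow_apply (waveHam lam b c) w t)
  have := HasDerivAt.fun_sum (u := Finset.univ) fun i _ =>
    ((h i).1.fun_mul (h i).2.2.1).fun_add ((h i).2.1.fun_mul (h i).2.2.2)
  refine this.congr_deriv ?_
  set z := linFlow (waveHam lam b c) t w
  simp only [waveDissipation, sq, Finset.sum_mul, ← Finset.sum_neg_distrib, neg_add,
    ← Finset.sum_add_distrib]
  exact Finset.sum_congr rfl fun i _ => by ring

/-- Without dissipation both coupling terms vanish and state and costate are free oscillators. The
observation then annihilates the state because no `c i` is zero, and the control functional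
annihilates the costate because no `b i` is zero. -/
theorem isDissipative_waveHam (hlam : Function.Injective lam) (hb : ∀ i, b i ≠ 0)
    (hc : ∀ i, c i ≠ 0) :
    IsDissipative (waveHam lam b c) wavePairing (waveDissipation b c) where
  continuous := by unfold wavePairing; fun_prop
  map_smul a w := by
    simp only [wavePairing, Finset.mul_sum]
    exact Finset.sum_congr rfl fun i _ => by simp; ring
  nonneg w := by unfold waveDissipation; positivity
  hasDerivAt := hasDerivAt_wavePairing
  observable w ε hε h0 := by
    set Z := fun t => linFlow (waveHam lam b c) t w with hZ
    have hd := fun t => hasDerivAt_waveHam_iff.1 (hasDerivAt_linFlow_apply (waveHam lam b c) w t)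
    have hz : ∀ t ∈ Ioo 0 ε, ∑ j, b j * (Z t).2.2 j = 0 ∧ ∑ j, c j * (Z t).1.1 j = 0 := by
      intro t ht
      have := h0 t ht
      rw [waveDissipation] at this
      constructor <;> nlinarith [sq_nonneg (∑ j, b j * (Z t).2.2 j),
        sq_nonneg (∑ j, c j * (Z t).1.1 j)]
    have h1 := oscillators_eq_zero (a := c) hlam (f := fun t => (Z t).1.1)
      (g := fun t => (Z t).1.2) (fun t _ i => (hd t i).1)
      (fun t ht i => (hd t i).2.1.congr_deriv (by
        have := (hz t ht).1
        simp only [hZ] at *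
        simp [this]))
      (fun t ht => (hz t ht).2)
    have h2 := oscillators_eq_zero (a := b) hlam (f := fun t => (Z t).2.2)
      (g := fun t i => -(Z t).2.1 i) (fun t _ i => (hd t i).2.2.2)
      (fun t ht i => (hd t i).2.2.1.fun_neg.congr_deriv (by
        have := (hz t ht).2
        simp only [hZ] at *
        simp [this]))
      (fun t ht => (hz t ht).1)
    have hmem : ε / 2 ∈ Ioo 0 ε := ⟨by linarith, by linarith⟩
    -- Everything vanishes at an interior time; injectivity of the flow carries this back to time 0.
    refine linFlow_injective (waveHam lam b c) (ε / 2) ?_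
    rw [map_zero]
    ext i
    · simpa [hc i] using (h1 _ hmem i).1
    · simpa [hc i] using (h1 _ hmem i).2
    · simpa [hb i] using (h2 _ hmem i).2
    · simpa [hb i] using (h2 _ hmem i).1

/-- The added 1 keeps the constant positive when there are no modes, as `IsDissipative.exists_bound`
requires. -/
theorem abs_wavePairing_le (w : WavePhase ι × WavePhase ι) :
    |wavePairing w| ≤ (2 * Fintype.card ι + 1) * ‖w.1‖ * ‖w.2‖ := by
  have h : ∀ i, |w.1.1 i * w.2.1 i + w.1.2 i * w.2.2 i| ≤ 2 * (‖w.1‖ * ‖w.2‖) := fun i => by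
    have e1 : |w.1.1 i| ≤ ‖w.1‖ := (norm_le_pi_norm w.1.1 i).trans (norm_fst_le w.1)
    have e2 : |w.1.2 i| ≤ ‖w.1‖ := (norm_le_pi_norm w.1.2 i).trans (norm_snd_le w.1)
    have e3 : |w.2.1 i| ≤ ‖w.2‖ := (norm_le_pi_norm w.2.1 i).trans (norm_fst_le w.2)
    have e4 : |w.2.2 i| ≤ ‖w.2‖ := (norm_le_pi_norm w.2.2 i).trans (norm_snd_le w.2)
    refine (abs_add_le _ _).trans ?_
    rw [abs_mul, abs_mul, two_mul]
    gcongr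
  calc |wavePairing w| ≤ ∑ i, |w.1.1 i * w.2.1 i + w.1.2 i * w.2.2 i| :=
        Finset.abs_sum_le_sum_abs _ _
    _ ≤ ∑ _i : ι, 2 * (‖w.1‖ * ‖w.2‖) := Finset.sum_le_sum fun i _ => h i
    _ = 2 * Fintype.card ι * ‖w.1‖ * ‖w.2‖ := by simp; ring
    _ ≤ _ := by gcongr; linarith

/-- Hamiltonian trajectories with bounded boundary data decay away from both ends of the time
interval. -/
theorem exists_waveHam_bound (hlam : Function.Injective lam) (hb : ∀ i, b i ≠ 0)
    (hc : ∀ i, c i ≠ 0) :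
    ∃ μ, 0 < μ ∧ ∃ C, 0 ≤ C ∧ ∀ Z : ℝ → WavePhase ι × WavePhase ι,
      (∀ t, HasDerivAt Z (waveHam lam b c (Z t)) t) → ∀ T, 0 < T → ∀ a, ‖(Z 0).1‖ ≤ a →
        ‖(Z T).2‖ ≤ a → ∀ t ∈ Icc 0 T,
          ‖Z t‖ ≤ C * a * (Real.exp (-μ * t) + Real.exp (-μ * (T - t))) := by
  obtain ⟨μ, hμ, C, hC, h⟩ := (isDissipative_waveHam hlam hb hc).exists_bound
    (M := 2 * Fintype.card ι + 1) (by positivity)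
    (fun w => (abs_wavePairing_le w).trans (by gcongr; exact norm_snd_le w))
    (fun w => (abs_wavePairing_le w).trans (by
      rw [mul_right_comm]; gcongr; exact norm_fst_le w))
  refine ⟨μ, hμ, C, hC, fun Z hZ T hT a ha1 ha2 t ht => ?_⟩
  rw [eq_linFlow _ hZ t]
  exact h T hT (Z 0) a ha1 (by rwa [← eq_linFlow _ hZ T]) t ht

/-- The two-point boundary value problem of the optimality system is solvable. -/
theorem exists_waveHam_boundary (hpos : ∀ i, 0 < lam i) {T : ℝ} (hT : 0 < T)
    (X P : WavePhase ι) : ∃ Z : ℝ → WavePhase ι × WavePhase ι,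
      (∀ t, HasDerivAt Z (waveHam lam b c (Z t)) t) ∧ (Z 0).1 = X ∧ (Z T).2 = P := by
  -- In finite dimension, injectivity of the map from the initial value to the boundary data is
  -- enough.
  let L : WavePhase ι × WavePhase ι →ₗ[ℝ] WavePhase ι × WavePhase ι :=
    (LinearMap.fst ℝ _ _).prod (LinearMap.snd ℝ _ _ ∘ₗ (linFlow (waveHam lam b c) T).toLinearMap)
  have hinj : Function.Injective L := by
    rw [injective_iff_map_eq_zero]
    intro w hw
    have hw1 : w.1 = 0 := congrArg Prod.fst hw
    have hw2 : (linFlow (waveHam lam b c) T w).2 = 0 := congrArg Prod.snd hw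
    have hanti : Antitone fun t => wavePairing (linFlow (waveHam lam b c) t w) :=
      antitone_of_hasDerivAt_nonpos (hasDerivAt_wavePairing w) fun t => by
        unfold waveDissipation; simp only [Pi.zero_apply]; rw [neg_nonpos]; positivity
    have h0 : wavePairing (linFlow (waveHam lam b c) 0 w) = 0 := by
      simp [linFlow_zero, wavePairing, hw1]
    have h1 : wavePairing (linFlow (waveHam lam b c) T w) = 0 := by simp [wavePairing, hw2]
    have hz : ∀ t ∈ Ioo 0 T,
        ∑ j, c j * (linFlow (waveHam lam b c) t w).1.1 j = 0 := by
      intro t ht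
      have := (hasDerivAt_wavePairing (lam := lam) (b := b) (c := c) w t).eq_zero_of_eqOn_Ioo ht
        fun s hs => le_antisymm (h0 ▸ hanti hs.1.le) (h1 ▸ hanti hs.2.le)
      rw [waveDissipation] at this
      nlinarith [sq_nonneg (∑ j, b j * (linFlow (waveHam lam b c) t w).2.2 j),
        sq_nonneg (∑ j, c j * (linFlow (waveHam lam b c) t w).1.1 j)]
    have hd := fun t => hasDerivAt_waveHam_iff.1 (hasDerivAt_linFlow_apply (waveHam lam b c) w t)
    -- Coefficients may vanish here, so full observability is unavailable. But the pairing is zero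
    -- at both ends, hence the observation is zero and each costate mode conserves its energy, which
    -- is zero at time `T`.
    have hE : ∀ i, w.2.1 i ^ 2 + lam i * w.2.2 i ^ 2 = 0 := fun i => by
      have := eq_of_hasDerivAt_eq_zero_Ioo hT (fun t =>
        ((hd t i).2.2.1.fun_pow 2).fun_add (((hd t i).2.2.2.fun_pow 2).const_mul (lam i)))
        (fun t ht => by rw [hz t ht]; push_cast; ring)
      simpa [linFlow_zero, hw2] using this
    refine Prod.ext hw1 ?_
    ext i
    · have := hE i
      have : 0 ≤ lam i * w.2.2 i ^ 2 := mul_nonneg (hpos i).le (sq_nonneg _)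
      have h3 : w.2.1 i ^ 2 = 0 := by nlinarith [sq_nonneg (w.2.1 i)]
      simpa using h3
    · have := hE i
      have h3 : lam i * w.2.2 i ^ 2 = 0 := by
        nlinarith [sq_nonneg (w.2.1 i), mul_nonneg (hpos i).le (sq_nonneg (w.2.2 i))]
      simpa [(hpos i).ne'] using h3
  obtain ⟨w, hw⟩ := (LinearMap.injective_iff_surjective.1 hinj) (X, P)
  exact ⟨fun t => linFlow (waveHam lam b c) t w, hasDerivAt_linFlow_apply _ w,
    by simp only [linFlow_zero]; exact congrArg Prod.fst hw, congrArg Prod.snd hw⟩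

end WaveHamiltonian

/-! ### The optimality system of the linear quadratic problem -/

theorem inner_matLin_left {ι κ : Type*} [Fintype ι] [DecidableEq ι] [Fintype κ] [DecidableEq κ]
    (M : Matrix κ ι ℝ) (x : EuclideanSpace ℝ ι) (y : EuclideanSpace ℝ κ) :
    inner ℝ (matLin M x) y = inner ℝ x (matLin M.transpose y) := by
  have h := M.toEuclideanLin_conjTranspose_eq_adjoint
  rw [Matrix.conjTranspose_eq_transpose_of_trivial] at h
  rw [← LinearMap.adjoint_inner_right]
  exact congrArg (fun f => inner ℝ x (f y)) h.symm

theorem continuous_matLin {ι κ : Type*} [Fintype ι] [DecidableEq ι] [Fintype κ]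
    (M : Matrix κ ι ℝ) : Continuous (matLin M) :=
  (matLin M).continuous_of_finiteDimensional

/-- Controls are only square integrable, so a primitive is merely absolutely continuous and has the
expected derivative almost everywhere. -/
theorem integral_mul_primitive {f f' g : ℝ → ℝ} {T : ℝ} (hf : ∀ t, HasDerivAt f (f' t) t)
    (hf' : Continuous f') (hg : IntervalIntegrable g volume 0 T) :
    ∫ t in (0 : ℝ)..T, f t * g t =
      f T * (∫ s in (0 : ℝ)..T, g s) - ∫ t in (0 : ℝ)..T, f' t * ∫ s in (0 : ℝ)..t, g s := by
  have hfac : AbsolutelyContinuousOnInterval f 0 T := by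
    have : ContDiff ℝ 1 f := contDiff_one_iff_deriv.2
      ⟨fun t => (hf t).differentiableAt, by
        rwa [show deriv f = f' from funext fun t => (hf t).deriv]⟩
    exact this.contDiffOn.absolutelyContinuousOnInterval
  have hgac := hg.absolutelyContinuousOnInterval_intervalIntegral (c := 0) left_mem_uIcc
  have h := hfac.integral_mul_deriv_eq_deriv_mul hgac
  simp only [intervalIntegral.integral_same, mul_zero, sub_zero] at h
  rw [show deriv f = f' from funext fun t => (hf t).deriv] at h
  rw [← h]
  refine intervalIntegral.integral_congr_ae ?_
  filter_upwards [hg.ae_hasDerivAt_integral] with t ht hmem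
  rw [(ht (uIoc_subset_uIcc hmem) 0 left_mem_uIcc).deriv]

theorem EuclideanSpace.intervalIntegral_apply {ι : Type*} [Fintype ι]
    {g : ℝ → EuclideanSpace ℝ ι} {a b : ℝ} (hg : IntervalIntegrable g volume a b) (i : ι) :
    (∫ t in a..b, g t) i = ∫ t in a..b, g t i :=
  ((EuclideanSpace.proj (𝕜 := ℝ) i).intervalIntegral_comp_comm hg).symm

theorem IntervalIntegrable.euclidean_apply {ι : Type*} [Fintype ι]
    {g : ℝ → EuclideanSpace ℝ ι} {a b : ℝ} (hg : IntervalIntegrable g volume a b) (i : ι) :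
    IntervalIntegrable (fun t => g t i) volume a b :=
  ⟨(EuclideanSpace.proj (𝕜 := ℝ) i).integrable_comp hg.1,
    (EuclideanSpace.proj (𝕜 := ℝ) i).integrable_comp hg.2⟩

/-- Integration by parts against the primitive of an integrable vector field. -/
theorem integral_inner_primitive {ι : Type*} [Fintype ι] {p p' g : ℝ → EuclideanSpace ℝ ι}
    {T : ℝ} (hp : ∀ t, HasDerivAt p (p' t) t) (hp' : Continuous p')
    (hg : IntervalIntegrable g volume 0 T) :
    ∫ t in (0 : ℝ)..T, inner ℝ (p t) (g t) = inner ℝ (p T) (∫ s in (0 : ℝ)..T, g s) -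
      ∫ t in (0 : ℝ)..T, inner ℝ (p' t) (∫ s in (0 : ℝ)..t, g s) := by
  have hpi : ∀ i t, HasDerivAt (fun t => p t i) (p' t i) t := fun i t =>
    (EuclideanSpace.proj (𝕜 := ℝ) i).hasFDerivAt.comp_hasDerivAt t (hp t)
  have hpc : Continuous p := continuous_iff_continuousAt.2 fun t => (hp t).continuousAt
  have hG : ContinuousOn (fun t => ∫ s in (0 : ℝ)..t, g s) (uIcc 0 T) :=
    intervalIntegral.continuousOn_primitive_interval' hg left_mem_uIcc
  have hsub : ∀ t ∈ uIcc 0 T, IntervalIntegrable g volume 0 t := fun t ht =>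
    hg.mono_set (uIcc_subset_uIcc_left ht)
  simp only [PiLp.inner_apply, RCLike.inner_apply, conj_trivial]
  rw [intervalIntegral.integral_finsetSum, intervalIntegral.integral_finsetSum,
    ← Finset.sum_sub_distrib]
  · refine Finset.sum_congr rfl fun i _ => ?_
    simp only [mul_comm _ (p _ _)]
    rw [integral_mul_primitive (hpi i) (by fun_prop) (hg.euclidean_apply i),
      EuclideanSpace.intervalIntegral_apply hg i]
    congr 1
    refine intervalIntegral.integral_congr fun t ht => ?_
    simp only
    rw [EuclideanSpace.intervalIntegral_apply (hsub t ht) i, mul_comm]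
  · intro i _
    refine ContinuousOn.intervalIntegrable ?_
    fun_prop
  · intro i _
    refine (hg.euclidean_apply i).mul_continuousOn ?_
    fun_prop

section Optimality

variable {ι m p : Type*} [Fintype ι] [DecidableEq ι] [Fintype m] [DecidableEq m]
  [Fintype p] [DecidableEq p] {A : Matrix ι ι ℝ} {B : Matrix ι m ℝ} {C : Matrix p ι ℝ}
  {T : ℝ} {x₀ : EuclideanSpace ℝ ι} {z : EuclideanSpace ℝ p}

theorem IsAdmissiblePair.intervalIntegrable_control {u : ℝ → EuclideanSpace ℝ m}
    {x : ℝ → EuclideanSpace ℝ ι} (hT : 0 ≤ T) (h : IsAdmissiblePair A B T x₀ u x) :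
    IntervalIntegrable u volume 0 T := by
  rw [intervalIntegrable_iff_integrableOn_Icc_of_le hT]
  exact h.1.integrable (by norm_num)

theorem IsAdmissiblePair.intervalIntegrable_velocity {u : ℝ → EuclideanSpace ℝ m}
    {x : ℝ → EuclideanSpace ℝ ι} (hT : 0 ≤ T) (h : IsAdmissiblePair A B T x₀ u x) :
    IntervalIntegrable (fun t => matLin A (x t) + matLin B (u t)) volume 0 T := by
  refine IntervalIntegrable.add (ContinuousOn.intervalIntegrable ?_) ?_
  · rw [uIcc_of_le hT]
    exact (continuous_matLin A).comp_continuousOn h.2.1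
  · have := h.intervalIntegrable_control hT
    exact ⟨(matLin B).toContinuousLinearMap.integrable_comp this.1,
      (matLin B).toContinuousLinearMap.integrable_comp this.2⟩

/-- A smooth solution of the optimality system: state equation, costate equation, and the
feedback law `u = -Bᵀ p`. -/
structure IsExtremal (A : Matrix ι ι ℝ) (B : Matrix ι m ℝ) (C : Matrix p ι ℝ) (T : ℝ)
    (x₀ : EuclideanSpace ℝ ι) (z : EuclideanSpace ℝ p) (u : ℝ → EuclideanSpace ℝ m)
    (x π : ℝ → EuclideanSpace ℝ ι) : Prop where
  state : ∀ t, HasDerivAt x (matLin A (x t) + matLin B (u t)) t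
  costate : ∀ t, HasDerivAt π
    (-(matLin A.transpose (π t) + matLin C.transpose (matLin C (x t) - z))) t
  control : ∀ t, u t = -matLin B.transpose (π t)
  initial : x 0 = x₀
  final : π T = 0

namespace IsExtremal

variable {u : ℝ → EuclideanSpace ℝ m} {x π : ℝ → EuclideanSpace ℝ ι}

theorem continuous_state (h : IsExtremal A B C T x₀ z u x π) : Continuous x :=
  continuous_iff_continuousAt.2 fun t => (h.state t).continuousAt

theorem continuous_costate (h : IsExtremal A B C T x₀ z u x π) : Continuous π :=
  continuous_iff_continuousAt.2 fun t => (h.costate t).continuousAt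

theorem continuous_control (h : IsExtremal A B C T x₀ z u x π) : Continuous u := by
  rw [funext h.control]
  exact ((continuous_matLin _).comp h.continuous_costate).neg

theorem isAdmissiblePair (h : IsExtremal A B C T x₀ z u x π) : IsAdmissiblePair A B T x₀ u x := by
  refine ⟨?_, h.continuous_state.continuousOn, fun t _ => ?_⟩
  · obtain ⟨M, hM⟩ := (isCompact_Icc (a := (0 : ℝ)) (b := T)).exists_bound_of_continuousOn
      h.continuous_control.continuousOn
    exact MemLp.of_bound h.continuous_control.aestronglyMeasurable M
      ((ae_restrict_iff' measurableSet_Icc).2 (ae_of_all _ hM))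
  · rw [intervalIntegral.integral_eq_sub_of_hasDerivAt (fun s _ => h.state s), h.initial]
    · abel
    · exact (((continuous_matLin A).comp h.continuous_state).add
        ((continuous_matLin B).comp h.continuous_control)).intervalIntegrable _ _

variable {v : ℝ → EuclideanSpace ℝ m} {y : ℝ → EuclideanSpace ℝ ι}

theorem sub_eq_integral (h : IsExtremal A B C T x₀ z u x π) (hv : IsAdmissiblePair A B T x₀ v y)
    {t : ℝ} (ht : t ∈ Icc 0 T) :
    y t - x t = ∫ s in (0 : ℝ)..t, (matLin A (y s - x s) + matLin B (v s - u s)) := by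
  have hT : 0 ≤ T := ht.1.trans ht.2
  have hsub : uIcc 0 t ⊆ uIcc 0 T := uIcc_subset_uIcc_left (by rwa [uIcc_of_le hT])
  rw [hv.2.2 t ht, h.isAdmissiblePair.2.2 t ht, add_sub_add_left_eq_sub,
    ← intervalIntegral.integral_sub ((hv.intervalIntegrable_velocity hT).mono_set hsub)
      ((h.isAdmissiblePair.intervalIntegrable_velocity hT).mono_set hsub)]
  refine intervalIntegral.integral_congr fun s _ => ?_
  simp only [map_sub]
  abel

/-- The costate is paired with the equation for the difference of the states and integrated by
parts. Boundary terms vanish because the costate is zero at `T` and the difference is zero at 0. -/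
theorem integral_variation_eq_zero (h : IsExtremal A B C T x₀ z u x π) (hT : 0 ≤ T)
    (hv : IsAdmissiblePair A B T x₀ v y) :
    ∫ t in (0 : ℝ)..T, (inner ℝ (u t) (v t - u t) +
      inner ℝ (matLin C (x t) - z) (matLin C (y t - x t))) = 0 := by
  have hx := h.continuous_state
  have hπ := h.continuous_costate
  have hu := h.continuous_control
  have hyc : ContinuousOn (fun t => y t - x t) (uIcc 0 T) := by
    rw [uIcc_of_le hT]
    exact hv.2.1.sub hx.continuousOn
  have hwi : IntervalIntegrable (fun t => v t - u t) volume 0 T :=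
    (hv.intervalIntegrable_control hT).sub (hu.intervalIntegrable _ _)
  have hA := continuous_matLin A
  have hAT := continuous_matLin A.transpose
  have hC := continuous_matLin C
  have hCT := continuous_matLin C.transpose
  have hg : IntervalIntegrable (fun t => matLin A (y t - x t) + matLin B (v t - u t))
      volume 0 T := by
    refine (ContinuousOn.intervalIntegrable (hA.comp_continuousOn hyc)).add ?_
    exact ⟨(matLin B).toContinuousLinearMap.integrable_comp hwi.1,
      (matLin B).toContinuousLinearMap.integrable_comp hwi.2⟩
  have key := integral_inner_primitive h.costate (by fun_prop) hg
  rw [h.final, inner_zero_left, zero_sub, ← intervalIntegral.integral_neg] at key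
  have hp : ∀ t ∈ uIcc 0 T, -inner ℝ
      (-(matLin A.transpose (π t) + matLin C.transpose (matLin C (x t) - z)))
      (∫ s in (0 : ℝ)..t, (matLin A (y s - x s) + matLin B (v s - u s))) =
      inner ℝ (π t) (matLin A (y t - x t)) +
        inner ℝ (matLin C (x t) - z) (matLin C (y t - x t)) := by
    intro t ht
    rw [uIcc_of_le hT] at ht
    rw [← h.sub_eq_integral hv ht, inner_neg_left, neg_neg, inner_add_left, inner_matLin_left,
      inner_matLin_left, Matrix.transpose_transpose, Matrix.transpose_transpose]
  rw [intervalIntegral.integral_congr hp] at key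
  rw [← sub_eq_zero, ← intervalIntegral.integral_sub] at key
  · rw [← neg_eq_zero, ← intervalIntegral.integral_neg]
    refine Eq.trans (intervalIntegral.integral_congr fun t _ => ?_) key
    rw [h.control t, inner_add_right, inner_neg_left, inner_matLin_left,
      Matrix.transpose_transpose]
    ring
  · have hc := hπ.continuousOn (s := uIcc 0 T)
    have : ∀ i, IntervalIntegrable (fun t => π t i *
        (matLin A (y t - x t) + matLin B (v t - u t)) i) volume 0 T := fun i =>
      (hg.euclidean_apply i).continuousOn_mul (by fun_prop)
    simp only [PiLp.inner_apply, RCLike.inner_apply, conj_trivial, mul_comm _ (π _ _)]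
    simpa only [Finset.sum_fn] using IntervalIntegrable.sum Finset.univ fun i _ => this i
  · refine ContinuousOn.intervalIntegrable ?_
    have h1 := hA.comp_continuousOn hyc
    have h2 := hC.comp_continuousOn hyc
    have h3 : Continuous fun t => matLin C (x t) - z := by fun_prop
    exact (hπ.continuousOn.inner h1).add (h3.continuousOn.inner h2)


/-- The cost is quadratic, and the cross term of its expansion is the first variation, which
vanishes. The remaining square yields both optimality and uniqueness. -/
theorem evolutionCost_eq (h : IsExtremal A B C T x₀ z u x π) (hT : 0 ≤ T)
    (hv : IsAdmissiblePair A B T x₀ v y) :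
    evolutionCost C T z v y = evolutionCost C T z u x +
      (1 / 2) * ∫ t in (0 : ℝ)..T, (‖v t - u t‖ ^ 2 + ‖matLin C (y t - x t)‖ ^ 2) ∧
    IntervalIntegrable (fun t => ‖v t - u t‖ ^ 2) volume 0 T ∧
    IntervalIntegrable (fun t => ‖matLin C (y t - x t)‖ ^ 2) volume 0 T := by
  have hx := h.continuous_state
  have hu := h.continuous_control
  have hC := continuous_matLin C
  have hyc : ContinuousOn (fun t => y t - x t) (uIcc 0 T) := by
    rw [uIcc_of_le hT]
    exact hv.2.1.sub hx.continuousOn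
  have hwi : IntervalIntegrable (fun t => v t - u t) volume 0 T :=
    (hv.intervalIntegrable_control hT).sub (hu.intervalIntegrable _ _)
  have hw2 : IntervalIntegrable (fun t => ‖v t - u t‖ ^ 2) volume 0 T := by
    rw [intervalIntegrable_iff_integrableOn_Icc_of_le hT]
    exact (hv.1.sub h.isAdmissiblePair.1).integrable_norm_pow (by norm_num)
  have hd2 : IntervalIntegrable (fun t => ‖matLin C (y t - x t)‖ ^ 2) volume 0 T :=
    ((hC.comp_continuousOn hyc).norm.pow 2).intervalIntegrable
  have hcost : IntervalIntegrable (fun t => ‖u t‖ ^ 2 + ‖matLin C (x t) - z‖ ^ 2) volume 0 T := by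
    refine Continuous.intervalIntegrable ?_ _ _
    fun_prop
  have hcross : IntervalIntegrable (fun t => inner ℝ (u t) (v t - u t) +
      inner ℝ (matLin C (x t) - z) (matLin C (y t - x t))) volume 0 T := by
    refine IntervalIntegrable.add ?_ (ContinuousOn.intervalIntegrable ?_)
    · have : ∀ i, IntervalIntegrable (fun t => u t i * (v t - u t) i) volume 0 T := fun i =>
        (hwi.euclidean_apply i).continuousOn_mul (by fun_prop)
      simp only [PiLp.inner_apply, RCLike.inner_apply, conj_trivial, mul_comm _ (u _ _)]
      simpa only [Finset.sum_fn] using IntervalIntegrable.sum Finset.univ fun i _ => this i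
    · have h3 : Continuous fun t => matLin C (x t) - z := by fun_prop
      exact h3.continuousOn.inner (hC.comp_continuousOn hyc)
  refine ⟨?_, hw2, hd2⟩
  have key := h.integral_variation_eq_zero hT hv
  unfold evolutionCost
  rw [← mul_add, ← intervalIntegral.integral_add hcost (hw2.add hd2)]
  congr 1
  have hsum := intervalIntegral.integral_add (hcost.add (hw2.add hd2)) (hcross.const_mul 2)
  rw [intervalIntegral.integral_const_mul, key, mul_zero, add_zero] at hsum
  refine Eq.trans (intervalIntegral.integral_congr fun t _ => ?_) hsum
  have e1 : v t = u t + (v t - u t) := by abel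
  have e2 : matLin C (y t) - z = (matLin C (x t) - z) + matLin C (y t - x t) := by
    rw [map_sub]; abel
  rw [e2, norm_add_sq_real, show ‖v t‖ ^ 2 = ‖u t + (v t - u t)‖ ^ 2 by rw [← e1],
    norm_add_sq_real]
  ring

theorem isOptimalPair (h : IsExtremal A B C T x₀ z u x π) (hT : 0 ≤ T) :
    IsOptimalPair A B C T x₀ z u x := by
  refine ⟨h.isAdmissiblePair, fun v y hv => ?_⟩
  rw [(h.evolutionCost_eq hT hv).1, le_add_iff_nonneg_right]
  exact mul_nonneg (by norm_num)
    (intervalIntegral.integral_nonneg hT fun t _ => by positivity)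

/-- The optimal pair is unique. -/
theorem eq_of_isOptimalPair (h : IsExtremal A B C T x₀ z u x π) (hT : 0 ≤ T)
    (hv : IsOptimalPair A B C T x₀ z v y) :
    (∀ᵐ t ∂volume.restrict (Icc 0 T), v t = u t) ∧ ∀ t ∈ Icc 0 T, y t = x t := by
  obtain ⟨hcost, hw2, hd2⟩ := h.evolutionCost_eq hT hv.1
  have hle := hv.2 u x h.isAdmissiblePair
  have hw0 : ∫ t in (0 : ℝ)..T, ‖v t - u t‖ ^ 2 = 0 := by
    rw [hcost, intervalIntegral.integral_add hw2 hd2] at hle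
    have e1 : 0 ≤ ∫ t in (0 : ℝ)..T, ‖v t - u t‖ ^ 2 :=
      intervalIntegral.integral_nonneg hT fun t _ => by positivity
    have e2 : 0 ≤ ∫ t in (0 : ℝ)..T, ‖matLin C (y t - x t)‖ ^ 2 :=
      intervalIntegral.integral_nonneg hT fun t _ => by positivity
    linarith
  have hae : ∀ᵐ t ∂volume.restrict (Icc 0 T), v t = u t := by
    rw [intervalIntegral.integral_of_le hT, ← integral_Icc_eq_integral_Ioc,
      integral_eq_zero_iff_of_nonneg (fun t => by positivity)
        ((intervalIntegrable_iff_integrableOn_Icc_of_le hT).1 hw2)] at hw0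
    filter_upwards [hw0] with t ht
    simpa [sub_eq_zero] using ht
  refine ⟨hae, ?_⟩
  have hyc : ContinuousOn (fun t => y t - x t) (Icc 0 T) :=
    hv.1.2.1.sub h.continuous_state.continuousOn
  -- Once the controls agree almost everywhere, the difference of the states solves the homogeneous
  -- equation with zero initial value.
  have hδ : ∀ t ∈ Icc 0 T, y t - x t = ∫ s in (0 : ℝ)..t, matLin A (y s - x s) := by
    intro t ht
    rw [h.sub_eq_integral hv.1 ht]
    refine intervalIntegral.integral_congr_ae ?_
    filter_upwards [(ae_restrict_iff' measurableSet_Icc).1 hae] with s hs hmem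
    rw [uIoc_of_le ht.1] at hmem
    rw [hs ⟨hmem.1.le, hmem.2.trans ht.2⟩, sub_self, map_zero, add_zero]
  -- The competitor is continuous only on the interval; after constant extension its primitive is
  -- differentiable everywhere and ODE uniqueness applies.
  let η := IccExtend hT ((Icc 0 T).domRestrict fun t => y t - x t)
  have hη : Continuous η := (continuousOn_iff_continuous_domRestrict.1 hyc).Icc_extend'
  have hηeq : ∀ t ∈ Icc 0 T, η t = y t - x t := fun t ht => IccExtend_of_mem hT _ ht
  let Δ : ℝ → EuclideanSpace ℝ ι := fun t => ∫ s in (0 : ℝ)..t, matLin A (η s)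
  have hΔeq : ∀ t ∈ Icc 0 T, Δ t = η t := by
    intro t ht
    rw [hηeq t ht, hδ t ht]
    refine intervalIntegral.integral_congr fun s hs => ?_
    rw [uIcc_of_le ht.1] at hs
    rw [hηeq s ⟨hs.1, hs.2.trans ht.2⟩]
  have hΔ : ∀ t, HasDerivAt Δ (matLin A (η t)) t := fun t =>
    ((continuous_matLin A).comp hη).integral_hasStrictDerivAt 0 t |>.hasDerivAt
  have huniq := ODE_solution_unique_of_mem_Icc_right
    (v := fun _ => (matLin A).toContinuousLinearMap) (s := fun _ => univ) (f := Δ)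
    (g := fun _ => 0) (a := 0) (b := T)
    (fun t _ => (matLin A).toContinuousLinearMap.lipschitz.lipschitzOnWith)
    (continuous_iff_continuousAt.2 fun t => (hΔ t).continuousAt).continuousOn
    (fun t ht => by
      have := (hΔ t).hasDerivWithinAt (s := Ici t)
      rw [← hΔeq t ⟨ht.1, ht.2.le⟩] at this
      exact this)
    (fun t _ => mem_univ _) continuousOn_const
    (fun t _ => (hasDerivWithinAt_const t (Ici t) 0).congr_deriv (by simp))
    (fun t _ => mem_univ _) (by simp [Δ])
  intro t ht
  have := huniq ht
  rw [hΔeq t ht, hηeq t ht] at this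
  exact sub_eq_zero.1 this

end IsExtremal

end Optimality

/-! ### The projected wave equation in coordinates -/

section WaveMatrices

/-- The state vector with given position and velocity coefficients. -/
noncomputable def ofPhase (ι : Type*) [Fintype ι] :
    WavePhase ι →L[ℝ] EuclideanSpace ℝ (ι ⊕ ι) :=
  LinearMap.toContinuousLinearMap
    { toFun := fun X => WithLp.toLp 2 (Sum.elim X.1 X.2)
      map_add' := fun X Y => by ext (i | i) <;> simp
      map_smul' := fun a X => by ext (i | i) <;> simp }

@[simp] theorem ofPhase_inl {ι : Type*} [Fintype ι] (X : WavePhase ι) (i : ι) :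
    ofPhase ι X (Sum.inl i) = X.1 i := rfl

@[simp] theorem ofPhase_inr {ι : Type*} [Fintype ι] (X : WavePhase ι) (i : ι) :
    ofPhase ι X (Sum.inr i) = X.2 i := rfl

variable {n N : ℕ} {lam : ℕ → ℝ} {φ : ℕ → EuclideanSpace ℝ (Fin n) → ℝ}
  {a : EuclideanSpace ℝ (Fin n)}

@[simp] theorem matLin_waveA_inl (x : EuclideanSpace ℝ (Fin N ⊕ Fin N)) (i : Fin N) :
    matLin (waveA N lam) x (Sum.inl i) = x (Sum.inr i) := by
  simp [waveA, Matrix.mulVec, dotProduct, Matrix.one_apply]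

@[simp] theorem matLin_waveA_inr (x : EuclideanSpace ℝ (Fin N ⊕ Fin N)) (i : Fin N) :
    matLin (waveA N lam) x (Sum.inr i) = -(lam i * x (Sum.inl i)) := by
  simp [waveA, Matrix.mulVec, dotProduct, Matrix.diagonal_apply]

@[simp] theorem matLin_waveA_transpose_inl (x : EuclideanSpace ℝ (Fin N ⊕ Fin N)) (i : Fin N) :
    matLin (waveA N lam).transpose x (Sum.inl i) = -(lam i * x (Sum.inr i)) := by
  simp [waveA, Matrix.mulVec, dotProduct, Matrix.diagonal_apply]

@[simp] theorem matLin_waveA_transpose_inr (x : EuclideanSpace ℝ (Fin N ⊕ Fin N)) (i : Fin N) :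
    matLin (waveA N lam).transpose x (Sum.inr i) = x (Sum.inl i) := by
  simp [waveA, Matrix.mulVec, dotProduct, Matrix.one_apply]

@[simp] theorem matLin_waveB_inl (u : EuclideanSpace ℝ (Fin 1)) (i : Fin N) :
    matLin (waveB N φ a) u (Sum.inl i) = 0 := by
  simp [waveB, Matrix.mulVec, dotProduct]

@[simp] theorem matLin_waveB_inr (u : EuclideanSpace ℝ (Fin 1)) (i : Fin N) :
    matLin (waveB N φ a) u (Sum.inr i) = φ i a * u 0 := by
  simp [waveB, Matrix.mulVec, dotProduct]

@[simp] theorem matLin_waveB_transpose (x : EuclideanSpace ℝ (Fin N ⊕ Fin N)) (k : Fin 1) :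
    matLin (waveB N φ a).transpose x k = ∑ i : Fin N, φ i a * x (Sum.inr i) := by
  simp [waveB, Matrix.mulVec, dotProduct]

@[simp] theorem matLin_waveC (x : EuclideanSpace ℝ (Fin N ⊕ Fin N)) (k : Fin 1) :
    matLin (waveC N φ a) x k = ∑ i : Fin N, φ i a * x (Sum.inl i) := by
  simp [waveC, Matrix.mulVec, dotProduct]

@[simp] theorem matLin_waveC_transpose_inl (y : EuclideanSpace ℝ (Fin 1)) (i : Fin N) :
    matLin (waveC N φ a).transpose y (Sum.inl i) = φ i a * y 0 := by
  simp [waveC, Matrix.mulVec, dotProduct]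

@[simp] theorem matLin_waveC_transpose_inr (y : EuclideanSpace ℝ (Fin 1)) (i : Fin N) :
    matLin (waveC N φ a).transpose y (Sum.inr i) = 0 := by
  simp [waveC, Matrix.mulVec, dotProduct]

/-! ### The undetectable space of the projected wave equation -/

theorem matLin_waveA_pow_two_mul (x : EuclideanSpace ℝ (Fin N ⊕ Fin N)) (k : ℕ) (i : Fin N) :
    matLin (waveA N lam ^ (2 * k)) x (Sum.inl i) = (-lam i) ^ k * x (Sum.inl i) ∧
      matLin (waveA N lam ^ (2 * k)) x (Sum.inr i) = (-lam i) ^ k * x (Sum.inr i) := by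
  induction k with
  | zero => simp [matLin]
  | succ k ih =>
    have h : matLin (waveA N lam ^ (2 * (k + 1))) x =
        matLin (waveA N lam) (matLin (waveA N lam) (matLin (waveA N lam ^ (2 * k)) x)) := by
      rw [show 2 * (k + 1) = (2 * k + 1) + 1 by ring, pow_succ', pow_succ', matLin,
        Matrix.toLpLin_mul_same, Matrix.toLpLin_mul_same]
      rfl
    rw [h]
    simp only [matLin_waveA_inl, matLin_waveA_inr, ih.1, ih.2]
    constructor <;> ring

theorem matLin_waveA_pow_two_mul_add_one (x : EuclideanSpace ℝ (Fin N ⊕ Fin N)) (k : ℕ)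
    (i : Fin N) :
    matLin (waveA N lam ^ (2 * k + 1)) x (Sum.inl i) = (-lam i) ^ k * x (Sum.inr i) := by
  have h : matLin (waveA N lam ^ (2 * k + 1)) x =
      matLin (waveA N lam) (matLin (waveA N lam ^ (2 * k)) x) := by
    rw [pow_succ', matLin, Matrix.toLpLin_mul_same]
    rfl
  rw [h, matLin_waveA_inl, (matLin_waveA_pow_two_mul x k i).2]

/-- As A² acts by -λ_i on each mode, even powers give moments of the observed positions and odd
powers those of the velocities. The 2N powers provide exactly N moments of each kind. -/
theorem mem_unobservableSpace_wave_iff (hlam : Function.Injective fun i : Fin N => lam i)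
    (x : EuclideanSpace ℝ (Fin N ⊕ Fin N)) :
    x ∈ unobservableSpace (waveA N lam) (waveC N φ a) ↔
      ∀ i : Fin N, φ i a ≠ 0 → x (Sum.inl i) = 0 ∧ x (Sum.inr i) = 0 := by
  have hmul : ∀ k, matLin (waveC N φ a * waveA N lam ^ k) x =
      matLin (waveC N φ a) (matLin (waveA N lam ^ k) x) := fun k => by
    rw [matLin, Matrix.toLpLin_mul 2 2 2]
    rfl
  have hmem : x ∈ unobservableSpace (waveA N lam) (waveC N φ a) ↔
      ∀ k < 2 * N, ∑ i : Fin N, φ i a * matLin (waveA N lam ^ k) x (Sum.inl i) = 0 := by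
    have hcard : Fintype.card (Fin N ⊕ Fin N) = 2 * N := by simp [two_mul]
    simp only [unobservableSpace, Submodule.mem_iInf, LinearMap.mem_ker, hmul]
    constructor
    · intro h k hk
      have := congrArg (fun y => y 0) (h ⟨k, by omega⟩)
      simpa only [matLin_waveC, PiLp.zero_apply] using this
    · intro h k
      ext j
      rw [matLin_waveC, h k (by omega)]
      rfl
  have hneg : Function.Injective fun i : Fin N => -lam i := fun i j hij =>
    hlam (neg_injective hij)
  rw [hmem]
  constructor
  · intro h i hi
    have h1 := eq_zero_of_forall_sum_mul_pow_eq_zero (v := fun i : Fin N => φ i a * x (Sum.inl i))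
      hneg (fun k hk => by
        rw [Fintype.card_fin] at hk
        rw [← h (2 * k) (by omega)]
        refine Finset.sum_congr rfl fun i _ => ?_
        rw [(matLin_waveA_pow_two_mul x k i).1]
        ring)
    have h2 := eq_zero_of_forall_sum_mul_pow_eq_zero (v := fun i : Fin N => φ i a * x (Sum.inr i))
      hneg (fun k hk => by
        rw [Fintype.card_fin] at hk
        rw [← h (2 * k + 1) (by omega)]
        refine Finset.sum_congr rfl fun i _ => ?_
        rw [matLin_waveA_pow_two_mul_add_one x k i]
        ring)
    exact ⟨by simpa [hi] using congrFun h1 i, by simpa [hi] using congrFun h2 i⟩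
  · intro h k _
    refine Finset.sum_eq_zero fun i _ => ?_
    by_cases hi : φ i a = 0
    · rw [hi, zero_mul]
    · rcases Nat.even_or_odd' k with ⟨j, rfl | rfl⟩
      · rw [(matLin_waveA_pow_two_mul x j i).1, (h i hi).1, mul_zero, mul_zero]
      · rw [matLin_waveA_pow_two_mul_add_one x j i, (h i hi).2, mul_zero, mul_zero]

/-- An eigenvalue satisfies μ² = -λ_i < 0, so its real part is zero. No generalized eigenspace is
lost by restricting to nonnegative real part, and over ℂ they span. -/
theorem nonstableSpace_waveA (hpos : ∀ i : Fin N, 0 < lam i) :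
    nonstableSpace (waveA N lam) = ⊤ := by
  set f : Module.End ℂ (Fin N ⊕ Fin N → ℂ) :=
    Matrix.toLin' ((waveA N lam).map Complex.ofReal) with hf
  have hf1 : ∀ x i, f x (Sum.inl i) = x (Sum.inr i) := fun x i => by
    simp [hf, waveA, Matrix.mulVec, dotProduct, Matrix.one_apply, Matrix.fromBlocks_map]
  have hf2 : ∀ x i, f x (Sum.inr i) = -(lam i * x (Sum.inl i)) := fun x i => by
    simp [hf, waveA, Matrix.mulVec, dotProduct, Matrix.diagonal_apply, Matrix.fromBlocks_map]
  have hbot : ∀ μ : ℂ, μ.re < 0 → f.maxGenEigenspace μ = ⊥ := by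
    intro μ hμ
    by_contra hne
    have hev : f.HasEigenvalue μ := Module.End.HasUnifEigenvalue.lt zero_lt_one hne
    obtain ⟨x, hx⟩ := hev.exists_hasEigenvector
    refine hx.2 ?_
    have he : ∀ j, f x j = μ * x j := fun j => by
      rw [hx.apply_eq_smul]; rfl
    have hl : ∀ i, x (Sum.inl i) = 0 := fun i => by
      have h1 := he (Sum.inl i)
      have h2 := he (Sum.inr i)
      rw [hf1] at h1
      rw [hf2, h1] at h2
      have h3 : (μ ^ 2 + lam i) * x (Sum.inl i) = 0 := by linear_combination -h2
      rcases mul_eq_zero.1 h3 with h4 | h4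
      · have hre := congrArg Complex.re h4
        have him := congrArg Complex.im h4
        simp [sq] at hre him
        have := hpos i
        have h6 : μ.im = 0 := by
          have : μ.re * μ.im = 0 := by linarith
          exact (mul_eq_zero.1 this).resolve_left hμ.ne
        rw [h6] at hre
        nlinarith
      · exact h4
    ext (i | i)
    · exact hl i
    · rw [← hf1 x i, he, hl, mul_zero]; rfl
  have htop : (⨆ μ : ℂ, ⨆ _ : 0 ≤ μ.re, f.maxGenEigenspace μ) = ⊤ := by
    rw [eq_top_iff, ← Module.End.iSup_maxGenEigenspace_eq_top f]
    refine iSup_le fun μ => ?_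
    rcases lt_or_ge μ.re 0 with h | h
    · rw [hbot μ h]
      exact bot_le
    · exact le_iSup₂ (f := fun (μ : ℂ) (_ : 0 ≤ μ.re) => f.maxGenEigenspace μ) μ h
  rw [nonstableSpace, ← hf, htop]
  rfl

theorem mem_undetectableSpace_wave_iff (hpos : ∀ i : Fin N, 0 < lam i)
    (hlam : Function.Injective fun i : Fin N => lam i)
    (x : EuclideanSpace ℝ (Fin N ⊕ Fin N)) :
    x ∈ undetectableSpace (waveA N lam) (waveC N φ a) ↔
      ∀ i : Fin N, φ i a ≠ 0 → x (Sum.inl i) = 0 ∧ x (Sum.inr i) = 0 := by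
  rw [undetectableSpace, nonstableSpace_waveA hpos, inf_top_eq,
    mem_unobservableSpace_wave_iff hlam]

/-- The basis vectors of an observed mode are orthogonal to the undetectable space, so the
projection preserves these coordinates. Used to refute the turnpike. -/
theorem abs_le_norm_detectableProj_wave (hpos : ∀ i : Fin N, 0 < lam i)
    (hlam : Function.Injective fun i : Fin N => lam i)
    (x : EuclideanSpace ℝ (Fin N ⊕ Fin N)) {i : Fin N} (hi : φ i a ≠ 0) :
    |x (Sum.inl i)| ≤ ‖detectableProj (waveA N lam) (waveC N φ a) x‖ ∧
      |x (Sum.inr i)| ≤ ‖detectableProj (waveA N lam) (waveC N φ a) x‖ := by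
  set K := undetectableSpace (waveA N lam) (waveC N φ a) with hK
  have key : ∀ j : Fin N ⊕ Fin N, (∀ y ∈ K, y j = 0) →
      |x j| ≤ ‖detectableProj (waveA N lam) (waveC N φ a) x‖ := by
    intro j hj
    have hmem : EuclideanSpace.single j (1 : ℝ) ∈ Kᗮ := by
      rw [Submodule.mem_orthogonal]
      intro y hy
      simp [EuclideanSpace.inner_single_right, hj y hy]
    have h1 : x j = detectableProj (waveA N lam) (waveC N φ a) x j := by
      have := Submodule.starProjection_inner_eq_zero (K := Kᗮ) x _ hmem
      rw [EuclideanSpace.inner_single_right] at this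
      simp only [RCLike.conj_to_real, one_mul, PiLp.sub_apply] at this
      exact sub_eq_zero.1 this
    rw [h1, ← Real.norm_eq_abs]
    exact PiLp.norm_apply_le _ j
  exact ⟨key _ fun y hy => ((mem_undetectableSpace_wave_iff hpos hlam y).1 hy i hi).1,
    key _ fun y hy => ((mem_undetectableSpace_wave_iff hpos hlam y).1 hy i hi).2⟩

/-- The projection kills vectors supported on unobserved modes, so `w` may be chosen freely there.
Used to prove the turnpike. -/
theorem norm_detectableProj_wave_sub_le (hpos : ∀ i : Fin N, 0 < lam i)
    (hlam : Function.Injective fun i : Fin N => lam i)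
    (x y w : EuclideanSpace ℝ (Fin N ⊕ Fin N))
    (h : ∀ i : Fin N, φ i a ≠ 0 → x (Sum.inl i) - y (Sum.inl i) = w (Sum.inl i) ∧
      x (Sum.inr i) - y (Sum.inr i) = w (Sum.inr i)) :
    ‖detectableProj (waveA N lam) (waveC N φ a) x -
      detectableProj (waveA N lam) (waveC N φ a) y‖ ≤ ‖w‖ := by
  set K := undetectableSpace (waveA N lam) (waveC N φ a) with hK
  have hmem : x - y - w ∈ K := by
    rw [hK, mem_undetectableSpace_wave_iff hpos hlam]
    intro i hi
    simp [(h i hi).1, (h i hi).2]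
  have h1 : Kᗮ.starProjection (x - y - w) = 0 := by
    rw [Submodule.starProjection_orthogonal_apply_eq_zero hmem]
  rw [← map_sub]
  have h2 : detectableProj (waveA N lam) (waveC N φ a) (x - y) = Kᗮ.starProjection w := by
    rw [map_sub _ (x - y) w, sub_eq_zero] at h1
    exact h1
  rw [h2]
  exact Kᗮ.norm_starProjection_apply_le w

end WaveMatrices

/-! ### Dirichlet eigenvalues -/

theorem MemLp.integrable_real_inner {α F : Type*} [MeasurableSpace α] {ν : Measure α}
    [NormedAddCommGroup F] [InnerProductSpace ℝ F] {a b : α → F} (ha : MemLp a 2 ν)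
    (hb : MemLp b 2 ν) : Integrable (fun x => inner ℝ (a x) (b x)) ν := by
  refine (integrable_congr ?_).1 (L2.integrable_inner (𝕜 := ℝ) (ha.toLp a) (hb.toLp b))
  filter_upwards [ha.coeFn_toLp, hb.coeFn_toLp] with x h1 h2
  rw [h1, h2]

theorem tendsto_integral_inner_of_tendsto_eLpNorm {α F : Type*} [MeasurableSpace α]
    {ν : Measure α} [NormedAddCommGroup F] [InnerProductSpace ℝ F] {a b : α → F}
    {bk : ℕ → α → F} (ha : MemLp a 2 ν) (hb : MemLp b 2 ν) (hbk : ∀ k, MemLp (bk k) 2 ν)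
    (h : Tendsto (fun k => eLpNorm (fun x => bk k x - b x) 2 ν) atTop (𝓝 0)) :
    Tendsto (fun k => ∫ x, inner ℝ (a x) (bk k x) ∂ν) atTop (𝓝 (∫ x, inner ℝ (a x) (b x) ∂ν)) := by
  have hinner : ∀ {c : α → F} (hc : MemLp c 2 ν),
      inner ℝ (ha.toLp a) (hc.toLp c) = ∫ x, inner ℝ (a x) (c x) ∂ν := fun hc => by
    rw [L2.inner_def]
    refine integral_congr_ae ?_
    filter_upwards [ha.coeFn_toLp, hc.coeFn_toLp] with x h1 h2
    rw [h1, h2]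
  have hlim : Tendsto (fun k => (hbk k).toLp (bk k)) atTop (𝓝 (hb.toLp b)) :=
    (Lp.tendsto_Lp_iff_tendsto_eLpNorm'' bk hbk b hb).2 h
  have := (tendsto_const_nhds (x := ha.toLp a)).inner (𝕜 := ℝ) hlim
  simpa only [hinner] using this

section Dirichlet

variable {n : ℕ} {Ω : Set (EuclideanSpace ℝ (Fin n))}

namespace IsTestFunction

variable {ψ : EuclideanSpace ℝ (Fin n) → ℝ}

theorem memLp (hψ : IsTestFunction Ω ψ) : MemLp ψ 2 (volume.restrict Ω) :=
  (hψ.1.continuous.memLp_of_hasCompactSupport hψ.2.1).restrict Ω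

theorem memLp_gradient (hψ : IsTestFunction Ω ψ) :
    MemLp (gradient ψ) 2 (volume.restrict Ω) := by
  have hc : Continuous (gradient ψ) := by
    unfold gradient
    exact (LinearIsometryEquiv.continuous _).comp (hψ.1.continuous_fderiv (by simp))
  have hs : HasCompactSupport (gradient ψ) := by
    unfold gradient
    exact (hψ.2.1.fderiv ℝ).comp_left (map_zero _)
  exact (hc.memLp_of_hasCompactSupport hs).restrict Ω

theorem coord_mul (hψ : IsTestFunction Ω ψ) (i : Fin n) :
    IsTestFunction Ω fun x => x i * ψ x := by
  refine ⟨(contDiff_piLp_apply (p := 2) (i := i)).mul hψ.1, hψ.2.1.mul_left, ?_⟩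
  exact (tsupport_mul_subset_right (f := fun x : EuclideanSpace ℝ (Fin n) => x i)).trans hψ.2.2

end IsTestFunction

theorem fderiv_coord_mul {ψ : EuclideanSpace ℝ (Fin n) → ℝ} (hψ : Differentiable ℝ ψ) (i : Fin n)
    (x : EuclideanSpace ℝ (Fin n)) :
    fderiv ℝ (fun x => x i * ψ x) x (EuclideanSpace.single i 1) =
      ψ x + x i * fderiv ℝ ψ x (EuclideanSpace.single i 1) := by
  have h1 : HasFDerivAt (fun x : EuclideanSpace ℝ (Fin n) => x i)
      (EuclideanSpace.proj (𝕜 := ℝ) i) x := (EuclideanSpace.proj (𝕜 := ℝ) i).hasFDerivAt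
  rw [(h1.fun_mul (hψ x).hasFDerivAt).fderiv]
  simp
  ring

/-- Dirichlet eigenvalues of a bounded open set are positive. -/
theorem IsDirichletEigenfunction.pos {l : ℝ} {f : EuclideanSpace ℝ (Fin n) → ℝ} (hn : 1 ≤ n)
    (hΩ : IsOpen Ω) (hbdd : Bornology.IsBounded Ω) (h : IsDirichletEigenfunction Ω l f) :
    0 < l := by
  obtain ⟨hf0, G, ⟨hf, hG, hw, ψ, hψ, h1, h2⟩, heq⟩ := h
  have hlim1 := tendsto_integral_inner_of_tendsto_eLpNorm hf hf (fun k => (hψ k).memLp) h1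
  have hff : ∫ x in Ω, inner ℝ (f x) (f x) ≠ 0 := by
    intro h0
    rw [integral_eq_zero_iff_of_nonneg (fun x => real_inner_self_nonneg)
      (MemLp.integrable_real_inner hf hf)] at h0
    refine hf0 ?_
    filter_upwards [h0] with x hx
    simpa using hx
  by_contra hl
  rw [not_lt] at hl
  have hlim2 := tendsto_integral_inner_of_tendsto_eLpNorm hG hG (fun k => (hψ k).memLp_gradient) h2
  -- Testing the equation with approximants of `f`. If `l ≤ 0`, the identity forces the weak
  -- gradient to vanish.
  have hGG : ∫ x in Ω, inner ℝ (G x) (G x) = l * ∫ x in Ω, inner ℝ (f x) (f x) := by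
    refine tendsto_nhds_unique hlim2 ?_
    simp only [heq _ (hψ _)]
    refine Tendsto.const_mul l ?_
    simpa [mul_comm] using hlim1
  have hG0 : G =ᵐ[volume.restrict Ω] 0 := by
    have e1 : 0 ≤ ∫ x in Ω, inner ℝ (f x) (f x) := integral_nonneg fun x => real_inner_self_nonneg
    have e2 : 0 ≤ ∫ x in Ω, inner ℝ (G x) (G x) := integral_nonneg fun x => real_inner_self_nonneg
    have e3 : ∫ x in Ω, inner ℝ (G x) (G x) = 0 := by nlinarith
    rw [integral_eq_zero_iff_of_nonneg (fun x => real_inner_self_nonneg)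
      (MemLp.integrable_real_inner hG hG)] at e3
    filter_upwards [e3] with x hx
    simpa using hx
  let i : Fin n := ⟨0, hn⟩
  -- A Poincaré argument: with `G = 0`, testing the weak gradient against x_i ψ_k gives ∫ f ψ_k = -∫
  -- x_i f ∂_i ψ_k. In the limit ∫ f² = -∫ x_i f G_i = 0. Boundedness of the domain puts x_i f in
  -- L².
  let F : EuclideanSpace ℝ (Fin n) → EuclideanSpace ℝ (Fin n) :=
    fun x => (x i * f x) • EuclideanSpace.single i 1
  obtain ⟨R, hR⟩ := hbdd.exists_norm_le
  have hF : MemLp F 2 (volume.restrict Ω) := by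
    refine hf.of_le_mul (c := R) ?_ ?_
    · have hc : Continuous fun x : EuclideanSpace ℝ (Fin n) => x i := by fun_prop
      exact (hc.aestronglyMeasurable.mul hf.1).smul_const _
    · refine (ae_restrict_iff' hΩ.measurableSet).2 (ae_of_all _ fun x hx => ?_)
      simp only [F, norm_smul, norm_mul, PiLp.norm_single, norm_one, mul_one]
      gcongr
      exact (PiLp.norm_apply_le x i).trans (hR x hx)
  have hlim3 := tendsto_integral_inner_of_tendsto_eLpNorm hF hG (fun k => (hψ k).memLp_gradient) h2
  have hFG : ∫ x in Ω, inner ℝ (F x) (G x) = 0 := by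
    rw [integral_congr_ae (g := fun _ => (0 : ℝ)), integral_zero]
    filter_upwards [hG0] with x hx
    simp [hx]
  have hparts : ∀ k, ∫ x in Ω, inner ℝ (f x) (ψ k x) =
      -∫ x in Ω, inner ℝ (F x) (gradient (ψ k) x) := by
    intro k
    have h3 := hw _ ((hψ k).coord_mul i) (EuclideanSpace.single i 1)
    rw [integral_congr_ae (f := fun x => inner ℝ (G x) _ * _) (g := fun _ => (0 : ℝ)) (by
      filter_upwards [hG0] with x hx
      simp [hx]), integral_zero, neg_zero] at h3
    rw [← add_eq_zero_iff_eq_neg, ← integral_add (MemLp.integrable_real_inner hf (hψ k).memLp)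
      (MemLp.integrable_real_inner hF (hψ k).memLp_gradient), ← h3]
    refine integral_congr_ae (ae_of_all _ fun x => ?_)
    simp only [F]
    rw [fderiv_coord_mul ((hψ k).1.differentiable (by simp)), inner_smul_left,
      inner_gradient_right]
    simp
    ring
  rw [hFG] at hlim3
  refine hff (tendsto_nhds_unique hlim1 ?_)
  simp only [hparts]
  simpa using hlim3.neg

/-- A repeated eigenvalue would make two members of an orthonormal basis proportional. -/
theorem dirichletEigenvalues_injective (hsimple : HasSimpleDirichletSpectrum Ω)
    {lam : ℕ → ℝ} {φ : ℕ → EuclideanSpace ℝ (Fin n) → ℝ}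
    (e : HilbertBasis ℕ ℝ (Lp ℝ 2 (volume.restrict Ω)))
    (hφ_basis : ∀ k, e k =ᵐ[volume.restrict Ω] φ k)
    (hφ_eigen : ∀ k, IsDirichletEigenfunction Ω (lam k) (φ k)) : Function.Injective lam := by
  intro i j hij
  by_contra hne
  obtain ⟨c, hc⟩ := hsimple (lam i) (φ i) (φ j) (hφ_eigen i) (hij ▸ hφ_eigen j)
  have hej : e j = c • e i := by
    refine Lp.ext ?_
    filter_upwards [hφ_basis i, hφ_basis j, hc, Lp.coeFn_smul c (e i)] with x h1 h2 h3 h4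
    rw [h2, h3, h4, Pi.smul_apply, h1, smul_eq_mul]
  have h0 : inner ℝ (e j) (e j) = (0 : ℝ) := by
    nth_rw 2 [hej]
    rw [inner_smul_right, e.orthonormal.2 (Ne.symm hne), mul_zero]
  have h1 := e.orthonormal.1 j
  rw [inner_self_eq_zero] at h0
  rw [h0, norm_zero] at h1
  exact zero_ne_one h1

end Dirichlet

/-! ### Turnpike for the projected wave equation -/

theorem Fintype.sum_eq_sum_subtype {ι : Type*} [Fintype ι] (s : ι → Prop) [DecidablePred s]
    {f : ι → ℝ} (hf : ∀ i, ¬ s i → f i = 0) : ∑ i, f i = ∑ i : {i // s i}, f i := by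
  rw [← Fintype.sum_subtype_add_sum_subtype s f,
    Fintype.sum_eq_zero (fun i : {i // ¬ s i} => f i) (fun i => hf i i.2), add_zero]

section WaveTurnpike

variable {n N : ℕ} {lam : ℕ → ℝ} {φ : ℕ → EuclideanSpace ℝ (Fin n) → ℝ}
  {xcon xobs : EuclideanSpace ℝ (Fin n)}

/-- The phase coordinates of a state vector. -/
def toPhase {ι : Type*} (x : EuclideanSpace ℝ (ι ⊕ ι)) : WavePhase ι :=
  (fun i => x (Sum.inl i), fun i => x (Sum.inr i))

/-- Hamiltonian trajectories, shifted by a steady extremal, are extremals. -/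
theorem isExtremal_wave {Z : ℝ → WavePhase (Fin N) × WavePhase (Fin N)}
    (hZ : ∀ t, HasDerivAt Z
      (waveHam (fun i : Fin N => lam i) (fun i => φ i xcon) (fun i => φ i xobs) (Z t)) t)
    {T : ℝ} {x₀ xb πb : EuclideanSpace ℝ (Fin N ⊕ Fin N)} {ub z : EuclideanSpace ℝ (Fin 1)}
    (hstate : matLin (waveA N lam) xb + matLin (waveB N φ xcon) ub = 0)
    (hcostate : matLin (waveA N lam).transpose πb +
      matLin (waveC N φ xobs).transpose (matLin (waveC N φ xobs) xb - z) = 0)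
    (hcontrol : ub = -matLin (waveB N φ xcon).transpose πb)
    (h0 : (Z 0).1 = toPhase (x₀ - xb)) (hT : (Z T).2 = toPhase (-πb)) :
    IsExtremal (waveA N lam) (waveB N φ xcon) (waveC N φ xobs) T x₀ z
      (fun t => ub - matLin (waveB N φ xcon).transpose (ofPhase _ (Z t).2))
      (fun t => xb + ofPhase _ (Z t).1) (fun t => πb + ofPhase _ (Z t).2) where
  state t := by
    have h := ((ofPhase (Fin N)).hasFDerivAt.comp_hasDerivAt t (hZ t).fst).const_add xb
    refine h.congr_deriv ?_
    have e : matLin (waveA N lam) (xb + ofPhase _ (Z t).1) + matLin (waveB N φ xcon)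
        (ub - matLin (waveB N φ xcon).transpose (ofPhase _ (Z t).2)) =
        matLin (waveA N lam) (ofPhase _ (Z t).1) - matLin (waveB N φ xcon)
          (matLin (waveB N φ xcon).transpose (ofPhase _ (Z t).2)) := by
      rw [map_add, map_sub, ← sub_eq_zero, ← hstate]
      abel
    rw [e]
    ext (i | i) <;> simp [waveHam_apply]
  costate t := by
    have h := ((ofPhase (Fin N)).hasFDerivAt.comp_hasDerivAt t (hZ t).snd).const_add πb
    refine h.congr_deriv ?_
    have e : matLin (waveA N lam).transpose (πb + ofPhase _ (Z t).2) +
        matLin (waveC N φ xobs).transpose (matLin (waveC N φ xobs) (xb + ofPhase _ (Z t).1) - z) =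
        matLin (waveA N lam).transpose (ofPhase _ (Z t).2) + matLin (waveC N φ xobs).transpose
          (matLin (waveC N φ xobs) (ofPhase _ (Z t).1)) := by
      simp only [map_add, map_sub] at hcostate ⊢
      rw [← sub_eq_zero, ← hcostate]
      abel
    rw [e]
    ext (i | i)
    · simp [waveHam_apply]
      ring
    · simp [waveHam_apply]
  control t := by
    rw [map_add, hcontrol]
    abel
  initial := by
    rw [h0]
    ext (i | i) <;> simp [toPhase]
  final := by
    rw [hT]
    ext (i | i) <;> simp [toPhase]

/-- The steady gain from the control to the observation. -/
noncomputable def steadyGain (N : ℕ) (lam : ℕ → ℝ) (φ : ℕ → EuclideanSpace ℝ (Fin n) → ℝ)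
    (xcon xobs : EuclideanSpace ℝ (Fin n)) : ℝ :=
  ∑ i : Fin N, φ i xobs * (φ i xcon / lam i)

/-- The steady state generated by a constant control. -/
noncomputable def steadyState (N : ℕ) (lam : ℕ → ℝ) (φ : ℕ → EuclideanSpace ℝ (Fin n) → ℝ)
    (xcon : EuclideanSpace ℝ (Fin n)) (u : EuclideanSpace ℝ (Fin 1)) :
    EuclideanSpace ℝ (Fin N ⊕ Fin N) :=
  ofPhase _ (fun i => φ i xcon / lam i * u 0, 0)

/-- The optimal steady control. -/
noncomputable def steadyControl (N : ℕ) (lam : ℕ → ℝ) (φ : ℕ → EuclideanSpace ℝ (Fin n) → ℝ)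
    (xcon xobs : EuclideanSpace ℝ (Fin n)) (z : EuclideanSpace ℝ (Fin 1)) :
    EuclideanSpace ℝ (Fin 1) :=
  WithLp.toLp 2 fun _ => steadyGain N lam φ xcon xobs * z 0 /
    (1 + steadyGain N lam φ xcon xobs ^ 2)

/-- Positive eigenvalues make A invertible, so the steady problem reduces to a scalar quadratic in
the control. -/
theorem steady_constraint_iff (hpos : ∀ i : Fin N, 0 < lam i) (u : EuclideanSpace ℝ (Fin 1))
    (x : EuclideanSpace ℝ (Fin N ⊕ Fin N)) :
    matLin (waveA N lam) x + matLin (waveB N φ xcon) u = 0 ↔ x = steadyState N lam φ xcon u := by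
  constructor
  · intro h
    ext (i | i)
    · have := congrArg (fun y => y (Sum.inr i)) h
      simp only [PiLp.add_apply, matLin_waveA_inr, matLin_waveB_inr, PiLp.zero_apply] at this
      have hl := (hpos i).ne'
      simp only [steadyState, ofPhase_inl]
      field_simp
      linarith
    · have := congrArg (fun y => y (Sum.inl i)) h
      simpa [steadyState] using this
  · rintro rfl
    ext (i | i)
    · simp [steadyState]
    · have hl := (hpos i).ne'
      simp [steadyState]
      field_simp
      ring

theorem matLin_waveC_steadyState (u : EuclideanSpace ℝ (Fin 1)) (k : Fin 1) :
    matLin (waveC N φ xobs) (steadyState N lam φ xcon u) k =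
      steadyGain N lam φ xcon xobs * u 0 := by
  simp only [matLin_waveC, steadyState, ofPhase_inl, steadyGain, Finset.sum_mul]
  exact Finset.sum_congr rfl fun i _ => by ring

theorem steadyCost_steadyState (u z : EuclideanSpace ℝ (Fin 1)) :
    steadyCost (waveC N φ xobs) z u (steadyState N lam φ xcon u) =
      (1 / 2) * (u 0 ^ 2 + (steadyGain N lam φ xcon xobs * u 0 - z 0) ^ 2) := by
  rw [steadyCost, EuclideanSpace.real_norm_sq_eq, EuclideanSpace.real_norm_sq_eq]
  simp only [Finset.univ_unique, Finset.sum_singleton, PiLp.sub_apply, matLin_waveC_steadyState]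
  rfl

/-- The steady minimizer is unique. -/
theorem IsSteadyMinimizer.eq_steady (hpos : ∀ i : Fin N, 0 < lam i)
    {u z : EuclideanSpace ℝ (Fin 1)} {x : EuclideanSpace ℝ (Fin N ⊕ Fin N)}
    (h : IsSteadyMinimizer (waveA N lam) (waveB N φ xcon) (waveC N φ xobs) z u x) :
    u = steadyControl N lam φ xcon xobs z ∧
      x = steadyState N lam φ xcon (steadyControl N lam φ xcon xobs z) := by
  have hx := (steady_constraint_iff hpos u x).1 h.1
  have hle := h.2 (steadyControl N lam φ xcon xobs z) _
    ((steady_constraint_iff hpos _ _).2 rfl)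
  rw [hx, steadyCost_steadyState, steadyCost_steadyState] at hle
  have hu : u = steadyControl N lam φ xcon xobs z := by
    ext k
    rw [Subsingleton.elim k 0]
    set g := steadyGain N lam φ xcon xobs with hg
    set s := steadyControl N lam φ xcon xobs z 0 with hs
    have hgs : (1 + g ^ 2) * s = g * z 0 := by
      have : (1 + g ^ 2) ≠ 0 := by positivity
      rw [hs, steadyControl, ← hg]
      simp only
      field_simp
    -- Completing the square at the stationary point `s`, where (1 + g²)s = gz.
    have h1 : (1 + g ^ 2) * (u 0 - s) ^ 2 ≤ 0 := by
      have e : (1 + g ^ 2) * (u 0 - s) ^ 2 = (u 0 ^ 2 + (g * u 0 - z 0) ^ 2) -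
          (s ^ 2 + (g * s - z 0) ^ 2) - 2 * (u 0 - s) * ((1 + g ^ 2) * s - g * z 0) := by ring
      rw [e, hgs]
      linarith
    have h2 : (u 0 - s) ^ 2 ≤ 0 := by nlinarith [sq_nonneg (u 0 - s), sq_nonneg g]
    have h3 := pow_eq_zero_iff two_ne_zero |>.1 (le_antisymm h2 (sq_nonneg _))
    linarith
  exact ⟨hu, hu ▸ hx⟩

/-- The costate of the optimal steady pair. -/
noncomputable def steadyCostate (N : ℕ) (lam : ℕ → ℝ) (φ : ℕ → EuclideanSpace ℝ (Fin n) → ℝ)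
    (xcon xobs : EuclideanSpace ℝ (Fin n)) (z : EuclideanSpace ℝ (Fin 1)) :
    EuclideanSpace ℝ (Fin N ⊕ Fin N) :=
  ofPhase _ (0, fun i => φ i xobs / lam i *
    (steadyGain N lam φ xcon xobs * steadyControl N lam φ xcon xobs z 0 - z 0))

theorem steady_costate_equation (hpos : ∀ i : Fin N, 0 < lam i) (z : EuclideanSpace ℝ (Fin 1)) :
    matLin (waveA N lam).transpose (steadyCostate N lam φ xcon xobs z) +
      matLin (waveC N φ xobs).transpose (matLin (waveC N φ xobs)
        (steadyState N lam φ xcon (steadyControl N lam φ xcon xobs z)) - z) = 0 := by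
  ext (i | i)
  · have hl := (hpos i).ne'
    rw [PiLp.add_apply, matLin_waveA_transpose_inl, matLin_waveC_transpose_inl, PiLp.sub_apply,
      matLin_waveC_steadyState]
    simp only [steadyCostate, ofPhase_inr, PiLp.zero_apply]
    field_simp
    ring
  · simp [steadyCostate]

theorem steady_control_equation (z : EuclideanSpace ℝ (Fin 1)) :
    steadyControl N lam φ xcon xobs z =
      -matLin (waveB N φ xcon).transpose (steadyCostate N lam φ xcon xobs z) := by
  ext k
  rw [Subsingleton.elim k 0, PiLp.neg_apply, matLin_waveB_transpose]
  set g := steadyGain N lam φ xcon xobs with hg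
  have hsum : ∑ i : Fin N, φ i xcon * steadyCostate N lam φ xcon xobs z (Sum.inr i) =
      g * (g * steadyControl N lam φ xcon xobs z 0 - z 0) := by
    conv_rhs => rw [hg, steadyGain, Finset.sum_mul]
    refine Finset.sum_congr rfl fun i _ => ?_
    simp only [steadyCostate, ofPhase_inr, ← hg]
    rw [← steadyGain, ← hg]
    ring
  rw [hsum]
  have : (1 + g ^ 2) ≠ 0 := by positivity
  simp only [steadyControl, ← hg]
  field_simp
  ring

end WaveTurnpike

/-! ### The two directions of the equivalence -/

section WaveTurnpike

variable {n N : ℕ} {lam : ℕ → ℝ} {φ : ℕ → EuclideanSpace ℝ (Fin n) → ℝ}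
  {xcon xobs : EuclideanSpace ℝ (Fin n)}

/-- An unobserved mode of the costate vanishes identically if it vanishes at the final time. -/
theorem costate_eq_zero_of_unobserved {ι : Type*} [Fintype ι] {lam b c : ι → ℝ} {i : ι}
    (hpos : 0 < lam i) (hc : c i = 0) {Z : ℝ → WavePhase ι × WavePhase ι}
    (hZ : ∀ t, HasDerivAt Z (waveHam lam b c (Z t)) t) {T : ℝ} (h1 : (Z T).2.1 i = 0)
    (h2 : (Z T).2.2 i = 0) (t : ℝ) : (Z t).2.1 i = 0 ∧ (Z t).2.2 i = 0 := by
  have hd := fun t => hasDerivAt_waveHam_iff.1 (hZ t) i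
  -- With `c i = 0` the costate mode is a free oscillator, whose energy is conserved.
  have hE : ∀ t, HasDerivAt (fun t => (Z t).2.1 i ^ 2 + lam i * (Z t).2.2 i ^ 2) 0 t := fun t =>
    (((hd t).2.2.1.fun_pow 2).fun_add (((hd t).2.2.2.fun_pow 2).const_mul (lam i))).congr_deriv
      (by rw [hc]; push_cast; ring)
  have := is_const_of_deriv_eq_zero (fun t => (hE t).differentiableAt) (fun t => (hE t).deriv) t T
  simp only [h1, h2] at this
  have e1 := mul_nonneg hpos.le (sq_nonneg ((Z t).2.2 i))
  have e2 := sq_nonneg ((Z t).2.1 i)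
  have e3 : (Z t).2.1 i ^ 2 = 0 := by linarith
  have e4 : lam i * (Z t).2.2 i ^ 2 = 0 := by linarith
  exact ⟨by simpa using e3, by simpa [hpos.ne'] using e4⟩

/-- If every observed mode is controlled, the turnpike estimate holds. -/
theorem cTurnpike_wave (hpos : ∀ i : Fin N, 0 < lam i)
    (hlam : Function.Injective fun i : Fin N => lam i)
    (h : ∀ i : Fin N, φ i xobs ≠ 0 → φ i xcon ≠ 0) :
    CTurnpike (waveA N lam) (waveB N φ xcon) (waveC N φ xobs) := by
  classical
  let S := {i : Fin N // φ i xobs ≠ 0}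
  obtain ⟨μ, hμ, C, hC, hbound⟩ := exists_waveHam_bound (ι := S)
    (lam := fun i => lam i) (b := fun i => φ i xcon) (c := fun i => φ i xobs)
    (fun i j hij => Subtype.ext (hlam hij)) (fun i => h i i.2) (fun i => i.2)
  refine ⟨μ, hμ, fun x₀ z => ?_⟩
  set ub := steadyControl N lam φ xcon xobs z with hub
  set xb := steadyState N lam φ xcon ub with hxb
  set πb := steadyCostate N lam φ xcon xobs z with hπb
  -- The boundary data of the shifted system involve only `x₀`, `z` and the steady extremal, so the
  -- constant does not depend on `T`.
  set a := max ‖toPhase (x₀ - xb)‖ ‖toPhase (-πb)‖ with ha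
  refine ⟨((∑ i : S, |φ i xcon|) + ‖ofPhase (Fin N)‖) * (C * a), fun T hT u x hux v y hvy => ?_⟩
  obtain ⟨hv, hy⟩ := hvy.eq_steady hpos
  obtain ⟨Z, hZ, hZ0, hZT⟩ := exists_waveHam_boundary (b := fun i : Fin N => φ i xcon)
    (c := fun i => φ i xobs) hpos hT (toPhase (x₀ - xb)) (toPhase (-πb))
  have hext := isExtremal_wave hZ ((steady_constraint_iff hpos _ _).2 hxb)
    (steady_costate_equation hpos z) (steady_control_equation z) hZ0 hZT
  obtain ⟨hu, hx⟩ := hext.eq_of_isOptimalPair hT.le hux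
  -- The steady costate has no component on unobserved modes, so the shifted costate has zero final
  -- data there.
  have hzero : ∀ t (i : Fin N), ¬ φ i xobs ≠ 0 → (Z t).2.1 i = 0 ∧ (Z t).2.2 i = 0 := by
    intro t i hi
    rw [not_not] at hi
    refine costate_eq_zero_of_unobserved (lam := fun i : Fin N => lam i) (hpos i) hi hZ (T := T)
      ?_ ?_ t
    · rw [hZT]
      simp [toPhase, hπb, steadyCostate]
    · rw [hZT]
      simp [toPhase, hπb, steadyCostate, hi]
  -- Restriction to the observed modes. It is again Hamiltonian, because the control and the
  -- observation involve no other mode.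
  let Y : ℝ → WavePhase S × WavePhase S := fun t =>
    ((fun i => (Z t).1.1 i, fun i => (Z t).1.2 i), (fun i => (Z t).2.1 i, fun i => (Z t).2.2 i))
  have hb : ∀ t, ∑ i : Fin N, φ i xcon * (Z t).2.2 i = ∑ i : S, φ i xcon * (Y t).2.2 i :=
    fun t => Fintype.sum_eq_sum_subtype _ fun i hi => by rw [(hzero t i hi).2, mul_zero]
  have hc : ∀ t, ∑ i : Fin N, φ i xobs * (Z t).1.1 i = ∑ i : S, φ i xobs * (Y t).1.1 i :=
    fun t => Fintype.sum_eq_sum_subtype _ fun i hi => by rw [not_not.1 hi, zero_mul]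
  have hY : ∀ t, HasDerivAt Y (waveHam (fun i : S => lam i) (fun i => φ i xcon)
      (fun i => φ i xobs) (Y t)) t := by
    intro t
    rw [hasDerivAt_waveHam_iff]
    intro i
    have := hasDerivAt_waveHam_iff.1 (hZ t) i
    rw [hb, hc] at this
    exact this
  have hY0 : ‖(Y 0).1‖ ≤ a := by
    refine le_trans ?_ (le_max_left _ _)
    rw [← hZ0]
    refine norm_prod_le_iff.2 ⟨(pi_norm_le_iff_of_nonneg (norm_nonneg _)).2 fun i => ?_,
      (pi_norm_le_iff_of_nonneg (norm_nonneg _)).2 fun i => ?_⟩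
    · exact (norm_le_pi_norm (Z 0).1.1 i).trans (norm_fst_le _)
    · exact (norm_le_pi_norm (Z 0).1.2 i).trans (norm_snd_le _)
  have hYT : ‖(Y T).2‖ ≤ a := by
    refine le_trans ?_ (le_max_right _ _)
    rw [← hZT]
    refine norm_prod_le_iff.2 ⟨(pi_norm_le_iff_of_nonneg (norm_nonneg _)).2 fun i => ?_,
      (pi_norm_le_iff_of_nonneg (norm_nonneg _)).2 fun i => ?_⟩
    · exact (norm_le_pi_norm (Z T).2.1 i).trans (norm_fst_le _)
    · exact (norm_le_pi_norm (Z T).2.2 i).trans (norm_snd_le _)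
  filter_upwards [hu, ae_restrict_mem measurableSet_Icc] with t hut ht
  have hYt := hbound Y hY T hT a hY0 hYT t ht
  have h1 : ‖u t - v‖ ≤ (∑ i : S, |φ i xcon|) * ‖Y t‖ := by
    rw [hut, hv, sub_sub_cancel_left, norm_neg, EuclideanSpace.norm_eq, Finset.univ_unique,
      Finset.sum_singleton, Real.sqrt_sq (norm_nonneg _), matLin_waveB_transpose]
    simp only [ofPhase_inr]
    rw [hb, Finset.sum_mul]
    refine (norm_sum_le _ _).trans (Finset.sum_le_sum fun i _ => ?_)
    rw [norm_mul]
    refine mul_le_mul_of_nonneg_left ?_ (norm_nonneg _)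
    exact (norm_le_pi_norm (Y t).2.2 i).trans ((norm_snd_le _).trans (norm_snd_le _))
  have h2 : ‖detectableProj (waveA N lam) (waveC N φ xobs) (x t) -
      detectableProj (waveA N lam) (waveC N φ xobs) y‖ ≤ ‖ofPhase (Fin N)‖ * ‖Y t‖ := by
    let W : WavePhase (Fin N) := (fun i => if φ i xobs = 0 then 0 else (Z t).1.1 i,
      fun i => if φ i xobs = 0 then 0 else (Z t).1.2 i)
    refine (norm_detectableProj_wave_sub_le hpos hlam (x t) y (ofPhase _ W) fun i hi => ?_).trans ?_
    · rw [hx t ht, hy, ← hub, ← hxb]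
      simp [W, hi]
    · refine ((ofPhase (Fin N)).le_opNorm W).trans (mul_le_mul_of_nonneg_left ?_ (norm_nonneg _))
      refine norm_prod_le_iff.2 ⟨(pi_norm_le_iff_of_nonneg (norm_nonneg _)).2 fun i => ?_,
        (pi_norm_le_iff_of_nonneg (norm_nonneg _)).2 fun i => ?_⟩
      · by_cases hi : φ i xobs = 0
        · simp [W, hi]
        · simp only [W, hi, if_false]
          exact (norm_le_pi_norm (Y t).1.1 ⟨i, hi⟩).trans ((norm_fst_le _).trans (norm_fst_le _))
      · by_cases hi : φ i xobs = 0
        · simp [W, hi]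
        · simp only [W, hi, if_false]
          exact (norm_le_pi_norm (Y t).1.2 ⟨i, hi⟩).trans ((norm_snd_le _).trans (norm_fst_le _))
  calc ‖u t - v‖ + ‖detectableProj (waveA N lam) (waveC N φ xobs) (x t) -
      detectableProj (waveA N lam) (waveC N φ xobs) y‖
      ≤ ((∑ i : S, |φ i xcon|) + ‖ofPhase (Fin N)‖) * ‖Y t‖ := by linarith
    _ ≤ ((∑ i : S, |φ i xcon|) + ‖ofPhase (Fin N)‖) *
        (C * a * (Real.exp (-μ * t) + Real.exp (-μ * (T - t)))) := by
        gcongr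
    _ = _ := by ring

/-- An observed mode that is not controlled oscillates freely, which rules out the turnpike
estimate. -/
theorem not_cTurnpike_wave (hpos : ∀ i : Fin N, 0 < lam i)
    (hlam : Function.Injective fun i : Fin N => lam i) {i : Fin N} (hc : φ i xobs ≠ 0)
    (hb : φ i xcon = 0) : ¬ CTurnpike (waveA N lam) (waveB N φ xcon) (waveC N φ xobs) := by
  rintro ⟨μ, hμ, h⟩
  -- Unit displacement in the uncontrolled mode; with target 0 the steady optimum is 0.
  set x₀ : EuclideanSpace ℝ (Fin N ⊕ Fin N) := EuclideanSpace.single (Sum.inl i) 1 with hx₀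
  obtain ⟨K, hK⟩ := h x₀ 0
  have hmin : IsSteadyMinimizer (waveA N lam) (waveB N φ xcon) (waveC N φ xobs) 0 0 0 := by
    refine ⟨by simp, fun v y _ => ?_⟩
    have h0 : steadyCost (waveC N φ xobs) 0 (0 : EuclideanSpace ℝ (Fin 1)) 0 = 0 := by
      simp [steadyCost]
    rw [h0, steadyCost]
    positivity
  have key : ∀ T, 0 < T →
      lam i ≤ (lam i + 1) * (|K| * (2 * Real.exp (-(μ / 3 * T)))) ^ 2 := by
    intro T hT
    obtain ⟨Z, hZ, hZ0, hZT⟩ := exists_waveHam_boundary (b := fun i : Fin N => φ i xcon)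
      (c := fun i => φ i xobs) hpos hT (toPhase (x₀ - 0)) (toPhase (-0))
    have hext := isExtremal_wave (xb := 0) (πb := 0) (ub := 0) (z := 0) hZ (by simp) (by simp)
      (by simp) hZ0 hZT
    have hae := hK T hT _ _ (hext.isOptimalPair hT.le) 0 0 hmin
    rw [ae_restrict_iff' measurableSet_Icc] at hae
    -- The estimate holds almost everywhere, hence on a dense set, which meets the middle third.
    -- There both exponentials are at most e^{-μT/3}.
    obtain ⟨t, htmem, ht⟩ := (Measure.dense_of_ae hae).exists_mem_open
      (isOpen_Ioo (a := T / 3) (b := 2 * T / 3)) ⟨T / 2, by linarith, by linarith⟩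
    have htT : t ∈ Icc 0 T := ⟨by linarith [ht.1], by linarith [ht.2]⟩
    have hbd := htmem htT
    simp only [map_zero, sub_zero, zero_add] at hbd
    obtain ⟨hq, hv⟩ := abs_le_norm_detectableProj_wave (φ := φ) (a := xobs) hpos hlam
      (ofPhase _ (Z t).1) hc
    rw [ofPhase_inl] at hq
    rw [ofPhase_inr] at hv
    have hd := fun t => hasDerivAt_waveHam_iff.1 (hZ t) i
    -- Since the control coefficient is zero, the energy of this mode keeps its initial value λ_i.
    have hE : ∀ t, HasDerivAt (fun t => lam i * (Z t).1.1 i ^ 2 + (Z t).1.2 i ^ 2) 0 t := fun t =>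
      ((((hd t).1.fun_pow 2).const_mul (lam i)).fun_add ((hd t).2.1.fun_pow 2)).congr_deriv
        (by rw [hb]; push_cast; ring)
    have hconst := is_const_of_deriv_eq_zero (fun t => (hE t).differentiableAt)
      (fun t => (hE t).deriv) t 0
    simp only [hZ0] at hconst
    have hconst' : lam i * (Z t).1.1 i ^ 2 + (Z t).1.2 i ^ 2 = lam i := by
      simpa [toPhase, hx₀] using hconst
    set d := ‖detectableProj (waveA N lam) (waveC N φ xobs) (ofPhase _ (Z t).1)‖ with hd'
    have hexp : Real.exp (-μ * t) + Real.exp (-μ * (T - t)) ≤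
        2 * Real.exp (-(μ / 3 * T)) := by
      have e1 : Real.exp (-μ * t) ≤ Real.exp (-(μ / 3 * T)) :=
        Real.exp_le_exp.2 (by nlinarith [ht.1])
      have e2 : Real.exp (-μ * (T - t)) ≤ Real.exp (-(μ / 3 * T)) :=
        Real.exp_le_exp.2 (by nlinarith [ht.2])
      linarith
    have hdle : d ≤ |K| * (2 * Real.exp (-(μ / 3 * T))) := by
      have e1 : d ≤ K * (Real.exp (-μ * t) + Real.exp (-μ * (T - t))) :=
        (le_add_of_nonneg_left (norm_nonneg _)).trans hbd
      refine e1.trans ?_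
      gcongr
      exact le_abs_self K
    have hd0 : 0 ≤ d := norm_nonneg _
    have hq2 : (Z t).1.1 i ^ 2 ≤ d ^ 2 := sq_le_sq' (abs_le.1 hq).1 (abs_le.1 hq).2
    have hv2 : (Z t).1.2 i ^ 2 ≤ d ^ 2 := sq_le_sq' (abs_le.1 hv).1 (abs_le.1 hv).2
    calc lam i ≤ lam i * d ^ 2 + d ^ 2 := by
          have := mul_le_mul_of_nonneg_left hq2 (hpos i).le
          linarith
      _ = (lam i + 1) * d ^ 2 := by ring
      _ ≤ _ := by
          have := (hpos i).le
          gcongr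
  have hlim : Tendsto (fun T : ℝ => (lam i + 1) * (|K| * (2 * Real.exp (-(μ / 3 * T)))) ^ 2)
      atTop (𝓝 ((lam i + 1) * (|K| * (2 * 0)) ^ 2)) := by
    have : Tendsto (fun T : ℝ => Real.exp (-(μ / 3 * T))) atTop (𝓝 0) :=
      Real.tendsto_exp_neg_atTop_nhds_zero.comp
        (tendsto_id.const_mul_atTop (by positivity : 0 < μ / 3))
    exact (((this.const_mul 2).const_mul |K|).pow 2).const_mul _
  have := ge_of_tendsto hlim (by filter_upwards [eventually_gt_atTop 0] with T hT using key T hT)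
  simp only [mul_zero, ne_eq, OfNat.ofNat_ne_zero, not_false_eq_true, zero_pow] at this
  exact (hpos i).not_ge this

end WaveTurnpike

theorem proposition1p3
    (n : ℕ) (hn : 1 ≤ n ∧ n ≤ 3)
    (Ω : Set (EuclideanSpace ℝ (Fin n)))
    (hΩ_open : IsOpen Ω) (hΩ_conn : IsConnected Ω) (hΩ_bdd : Bornology.IsBounded Ω)
    (hΩ_smooth : HasSmoothBoundary Ω)
    (hsimple : HasSimpleDirichletSpectrum Ω)
    (lam : ℕ → ℝ) (φ : ℕ → EuclideanSpace ℝ (Fin n) → ℝ)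
    (e : HilbertBasis ℕ ℝ (Lp ℝ 2 (volume.restrict Ω)))
    (hφ_basis : ∀ k, e k =ᵐ[volume.restrict Ω] φ k)
    (hφ_cont : ∀ k, ContinuousOn (φ k) Ω)
    (hφ_eigen : ∀ k, IsDirichletEigenfunction Ω (lam k) (φ k))
    (xcon xobs : EuclideanSpace ℝ (Fin n)) (hxcon : xcon ∈ Ω) (hxobs : xobs ∈ Ω)
    (N : ℕ) (hN : 0 < N) :
    CTurnpike (waveA N lam) (waveB N φ xcon) (waveC N φ xobs) ↔
      ∀ i : Fin N, φ i xobs ≠ 0 → φ i xcon ≠ 0 := by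
  have hpos : ∀ i : Fin N, 0 < lam i := fun i => (hφ_eigen i).pos hn.1 hΩ_open hΩ_bdd
  have hlam : Function.Injective fun i : Fin N => lam i := fun i j hij =>
    Fin.ext (dirichletEigenvalues_injective hsimple e hφ_basis hφ_eigen hij)
  refine ⟨fun h i hobs hcon => not_cTurnpike_wave hpos hlam hobs hcon h,
    cTurnpike_wave hpos hlam⟩
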